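/- Let $s\geq 2$ and $t\geq 1$ be coprime integers, and let $u=\lfloor s/2\rfloor$. A partition is an $s$-core if none of its hook lengths equals $s$; an $(s,t)$-core is a partition that is both an $s$-core and a $t$-core. The beta-set of a partition $\lambda=(\lambda_1,\lambda_2,\dots)$ is $\mathcal B^\lambda=\{\lambda_i-i : i\geq 1\}$. Let $\tilde{\mathfrak S}_s$ be the affine symmetric group of all permutations $w$ of $\mathbb Z$ with $w(m+s)=w(m)+s$ for all $m$ and $w(0)+\dots+w(s-1)=\binom s2$. It is generated by the elements $w_i$ ($i\in\mathbb Z/s\mathbb Z$), where $w_i$ sends $m$ to $m+1$ if $m\in i-1$, to $m-1$ if $m\in i$, and to $m$ otherwise. For $i\in\mathbb Z/s\mathbb Z$ let $v_i=w_i$ if $i=\bar 0$, let $v_i=w_iw_{-i}$ if $i=\pm\bar l$ with $1\leq l<u$, and let $v_i=w_iw_{-i}w_i$ if $i=\pm\bar u$. Let $\tilde{\mathfrak H}_s$, the affine hyperoctahedral group, be the subgroup of $\tilde{\mathfrak S}_s$ generated by the $v_i$. Put $c=\frac12(s-1)(t-1)$. The level $t$ action $w\mapsto\mathring w$ of $\tilde{\mathfrak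 S}_s$ on $\mathbb Z$ is the action in which $\mathring w_i$ sends $m$ to $m+t$ if $m\in (i-1)t-c$, to $m-t$ if $m\in it-c$, and to $m$ otherwise. It induces an action $w\mapsto\check w$ on partitions by $\mathcal B^{\check w\lambda}=\mathring w\,\mathcal B^\lambda$, which restricts to an action of $\tilde{\mathfrak H}_s$ on the set of self-conjugate $s$-cores. For a self-conjugate $s$-core $\lambda$, let $\operatorname{StabSC}_{s,t}(\lambda)\leq\tilde{\mathfrak H}_s$ be its stabiliser under this action. Then there are only finitely many self-conjugate $(s,t)$-cores, each group $\operatorname{StabSC}_{s,t}(\lambda)$ with $\lambda$ a self-conjugate $(s,t)$-core is finite, and $$\sum_{\lambda}\frac{1}{|\operatorname{StabSC}_{s,t}(\lambda)|}=\frac{t^u}{2^u\,u!},$$ where the sum runs over all self-conjugate $(s,t)$-cores $\lambda$. -/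

import Mathlib

open Equiv

namespace CoreAction

/-! ### Partitions, cores and beta-sets

Partitions are Mathlib's Young diagrams, with rows and columns numbered from `0`. -/

/-- The hook length of the cell `c` of `μ`: arm length plus leg length plus one. -/
def hookLength (μ : YoungDiagram) (c : ℕ × ℕ) : ℕ :=
  (μ.rowLen c.1 - (c.2 + 1)) + (μ.colLen c.2 - (c.1 + 1)) + 1

/-- `μ` is an `s`-core if none of its hook lengths equals `s`. -/
def IsCore (s : ℕ) (μ : YoungDiagram) : Prop :=
  ∀ c ∈ μ.cells, hookLength μ c ≠ s

/-- `μ` is self-conjugate. -/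
def IsSelfConj (μ : YoungDiagram) : Prop := μ.transpose = μ

/-- The set of self-conjugate partitions which are both `s`-cores and `t`-cores. -/
def scCores (s t : ℕ) : Set YoungDiagram :=
  {μ | IsCore s μ ∧ IsCore t μ ∧ IsSelfConj μ}

/-- The `i`-th element of the beta-set; with rows numbered from `1` it is `μ_(i+1) - (i+1)`. -/
def betaFun (μ : YoungDiagram) (i : ℕ) : ℤ := (μ.rowLen i : ℤ) - ((i : ℤ) + 1)

/-- The beta-set `{μ_i - i : i ≥ 1}` of a partition. -/
def betaSet (μ : YoungDiagram) : Set ℤ := Set.range (betaFun μ)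

theorem betaFun_strictAnti (μ : YoungDiagram) : StrictAnti (betaFun μ) := by
  intro i j hij
  have := μ.rowLen_anti i j hij.le
  unfold betaFun
  omega

theorem rowLen_ext {μ ν : YoungDiagram} (h : ∀ i, μ.rowLen i = ν.rowLen i) : μ = ν := by
  ext ⟨i, j⟩
  simp only [YoungDiagram.mem_cells, YoungDiagram.mem_iff_lt_rowLen, h]

theorem betaSet_injective : Function.Injective betaSet := by
  intro μ ν h
  have hm : StrictMono (fun i => -betaFun μ i) := fun i j hij =>
    neg_lt_neg (betaFun_strictAnti μ hij)
  have hn : StrictMono (fun i => -betaFun ν i) := fun i j hij =>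
    neg_lt_neg (betaFun_strictAnti ν hij)
  have hr : Set.range (fun i => -betaFun μ i) = Set.range (fun i => -betaFun ν i) := by
    have := congrArg (fun S : Set ℤ => Neg.neg '' S) h
    simpa only [betaSet, ← Set.range_comp, Function.comp_def] using this
  have he := (hm.range_inj hn).1 hr
  refine rowLen_ext fun i => ?_
  have := congrFun he i
  simp only [betaFun] at this
  omega

/-- An intrinsic description of beta-sets, used only to show that the action below is well
defined. -/
def IsBeta (X : Set ℤ) : Prop :=
  ∃ N : ℕ, (∀ m : ℤ, m < -N → m ∈ X) ∧ (∀ m : ℤ, (N : ℤ) ≤ m → m ∉ X) ∧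
    (X ∩ Set.Ico (-(N : ℤ)) N).ncard = N

theorem isBeta_betaSet (μ : YoungDiagram) : IsBeta (betaSet μ) := by
  have hz : ∀ i, μ.colLen 0 ≤ i → μ.rowLen i = 0 := by
    intro i hi
    by_contra h
    have h1 : (i, 0) ∈ μ := YoungDiagram.mem_iff_lt_rowLen.2 (Nat.pos_of_ne_zero h)
    have := YoungDiagram.mem_iff_lt_colLen.1 h1
    omega
  refine ⟨μ.colLen 0 + μ.rowLen 0, ?_, ?_, ?_⟩
  · intro m hm
    refine ⟨(-m - 1).toNat, ?_⟩
    have := hz (-m - 1).toNat (by omega)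
    unfold betaFun
    omega
  · rintro m hm ⟨i, rfl⟩
    have := μ.rowLen_anti 0 i (Nat.zero_le i)
    unfold betaFun at hm
    omega
  · have : betaSet μ ∩ Set.Ico (-((μ.colLen 0 + μ.rowLen 0 : ℕ) : ℤ))
        ((μ.colLen 0 + μ.rowLen 0 : ℕ) : ℤ) =
        ((Finset.range (μ.colLen 0 + μ.rowLen 0)).image (betaFun μ) : Finset ℤ) := by
      ext m
      simp only [Set.mem_inter_iff, Set.mem_Ico, Finset.coe_image, Set.mem_image,
        Finset.coe_range, Set.mem_Iio]
      constructor
      · rintro ⟨⟨i, rfl⟩, h1, h2⟩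
        refine ⟨i, ?_, rfl⟩
        by_contra h
        have := hz i (by omega)
        unfold betaFun at h1
        omega
      · rintro ⟨i, hi, rfl⟩
        have := μ.rowLen_anti 0 i (Nat.zero_le i)
        refine ⟨⟨i, rfl⟩, ?_, ?_⟩ <;> unfold betaFun <;> omega
    rw [this, Set.ncard_coe_finset,
      Finset.card_image_of_injective _ (betaFun_strictAnti μ).injective, Finset.card_range]

/-- The Young diagram with prescribed row lengths. -/
theorem exists_rowLen (f : ℕ → ℕ) (hf : Antitone f) (N : ℕ) (hN : ∀ i, N ≤ i → f i = 0) :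
    ∃ μ : YoungDiagram, ∀ i, μ.rowLen i = f i := by
  refine ⟨⟨(Finset.range N ×ˢ Finset.range (f 0)).filter (fun c => c.2 < f c.1), ?_⟩, ?_⟩
  · rintro ⟨i, j⟩ ⟨k, l⟩ hle h
    obtain ⟨h1, h2⟩ := Prod.mk_le_mk.1 hle
    simp only [Finset.coe_filter, Finset.mem_product, Finset.mem_range, Set.mem_ofPred_eq] at h ⊢
    have := hf h1
    exact ⟨⟨by omega, by omega⟩, by omega⟩
  · intro i
    refine eq_of_forall_lt_iff fun j => ?_
    refine YoungDiagram.mem_iff_lt_rowLen.symm.trans ((YoungDiagram.mem_mk _ _ _).trans ?_)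
    simp only [Finset.mem_filter, Finset.mem_product, Finset.mem_range]
    constructor
    · exact fun h => h.2
    · intro h
      have := hf (Nat.zero_le i)
      refine ⟨⟨?_, by omega⟩, h⟩
      by_contra h'
      have := hN i (by omega)
      omega

theorem exists_betaSet {X : Set ℤ} (hX : IsBeta X) : ∃ μ, betaSet μ = X := by
  classical
  obtain ⟨N, h1, h2, h3⟩ := hX
  have hfin : (X ∩ Set.Ico (-(N : ℤ)) N).Finite := (Set.finite_Ico _ _).inter_of_right X
  set Z : Finset ℤ := hfin.toFinset with hZ
  have hc : Z.card = N := by rw [← h3, Set.ncard_eq_toFinset_card _ hfin]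
  have hmemZ : ∀ m, m ∈ Z ↔ m ∈ X ∧ -(N : ℤ) ≤ m ∧ m < N := by
    intro m; simp [hZ]
  set e := Z.orderEmbOfFin hc with he
  have hlow : ∀ k : ℕ, ∀ hk : k < N, -(N : ℤ) + k ≤ e ⟨k, hk⟩ := by
    intro k
    induction k with
    | zero =>
      intro hk
      have := (hmemZ _).1 (Z.orderEmbOfFin_mem hc ⟨0, hk⟩)
      simpa using this.2.1
    | succ k ih =>
      intro hk
      have a := ih (by omega)
      have b : e ⟨k, by omega⟩ < e ⟨k + 1, hk⟩ := e.strictMono (by simp)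
      push_cast
      omega
  set x : ℕ → ℤ := fun i => if h : i < N then e ⟨N - 1 - i, by omega⟩ else -(i : ℤ) - 1 with hx
  have hxlow : ∀ i : ℕ, -(i : ℤ) - 1 ≤ x i := by
    intro i
    by_cases h : i < N
    · have := hlow (N - 1 - i) (by omega)
      simp only [hx, h, dif_pos]
      omega
    · simp [hx, h]
  have hxs : ∀ i : ℕ, x (i + 1) < x i := by
    intro i
    by_cases h : i + 1 < N
    · have h' : i < N := by omega
      simp only [hx, h, h', dif_pos]
      apply e.strictMono
      simp only [Fin.mk_lt_mk]
      omega
    · have := hxlow i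
      have h0 : x (i + 1) = -((i + 1 : ℕ) : ℤ) - 1 := by simp only [hx, h, dif_neg, not_false_eq_true]
      rw [h0]
      push_cast
      omega
  obtain ⟨μ, hμ⟩ := exists_rowLen (fun i => (x i + i + 1).toNat)
    (antitone_nat_of_succ_le fun i => by
      have := hxs i
      push_cast
      omega) N (fun i hi => by
      have : ¬ i < N := by omega
      simp only [hx, this, dif_neg, not_false_eq_true]
      omega)
  have hb : betaFun μ = x := by
    funext i
    have := hxlow i
    simp only [betaFun, hμ]
    omega
  refine ⟨μ, ?_⟩
  ext m
  rw [betaSet, hb, Set.mem_range]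
  constructor
  · rintro ⟨i, rfl⟩
    by_cases h : i < N
    · simp only [hx, h, dif_pos]
      exact ((hmemZ _).1 (Z.orderEmbOfFin_mem hc _)).1
    · simp only [hx, h, dif_neg, not_false_eq_true]
      exact h1 _ (by omega)
  · intro hm
    by_cases hmN : m < -(N : ℤ)
    · refine ⟨(-m - 1).toNat, ?_⟩
      have : ¬ (-m - 1).toNat < N := by omega
      simp only [hx, this, dif_neg, not_false_eq_true]
      omega
    · have hmZ : m ∈ Z := (hmemZ m).2 ⟨hm, by omega, by
        by_contra h
        exact h2 m (by omega) hm⟩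
      have : m ∈ Set.range e := by rw [he, Finset.range_orderEmbOfFin]; exact hmZ
      obtain ⟨⟨k, hk⟩, rfl⟩ := this
      refine ⟨N - 1 - k, ?_⟩
      have h : N - 1 - k < N := by omega
      simp only [hx, h, dif_pos]
      congr 2
      omega

theorem isBeta_of_agree {X Y : Set ℤ} (hX : IsBeta X) (F : Set ℤ) (hF : F.Finite)
    (hout : ∀ m, m ∉ F → (m ∈ X ↔ m ∈ Y)) (hcard : (X ∩ F).ncard = (Y ∩ F).ncard) :
    IsBeta Y := by
  obtain ⟨N, h1, h2, h3⟩ := hX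
  -- enlarge the window
  have hstep : ∀ k : ℕ, (X ∩ Set.Ico (-((N + k : ℕ) : ℤ)) ((N + k : ℕ) : ℤ)).ncard = N + k := by
    intro k
    induction k with
    | zero => simpa using h3
    | succ k ih =>
      have : X ∩ Set.Ico (-((N + (k + 1) : ℕ) : ℤ)) ((N + (k + 1) : ℕ) : ℤ) =
          insert (-((N + (k + 1) : ℕ) : ℤ))
            (X ∩ Set.Ico (-((N + k : ℕ) : ℤ)) ((N + k : ℕ) : ℤ)) := by
        ext m
        simp only [Set.mem_inter_iff, Set.mem_Ico, Set.mem_insert_iff]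
        constructor
        · rintro ⟨hm, ha, hb⟩
          by_cases hm' : m = -((N + (k + 1) : ℕ) : ℤ)
          · exact Or.inl hm'
          · refine Or.inr ⟨hm, by omega, ?_⟩
            by_contra h
            exact h2 m (by omega) hm
        · rintro (rfl | ⟨hm, ha, hb⟩)
          · exact ⟨h1 _ (by omega), by omega, by omega⟩
          · exact ⟨hm, by omega, by omega⟩
      rw [this, Set.ncard_insert_of_notMem _ ((Set.finite_Ico _ _).inter_of_right X), ih]
      · omega
      · rintro ⟨-, h, -⟩
        omega
  obtain ⟨B, hB⟩ : ∃ B : ℕ, ∀ m ∈ F, -(B : ℤ) ≤ m ∧ m < B := by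
    obtain ⟨a, ha⟩ := hF.bddBelow
    obtain ⟨b, hb⟩ := hF.bddAbove
    refine ⟨a.natAbs + b.natAbs + 1, fun m hm => ?_⟩
    have h1 := ha hm
    have h2 := hb hm
    omega
  refine ⟨N + B, ?_, ?_, ?_⟩
  · intro m hm
    refine (hout m fun h => ?_).1 (h1 m (by omega))
    have := hB m h
    omega
  · intro m hm hY
    refine h2 m (by omega) ((hout m fun h => ?_).2 hY)
    have := hB m h
    omega
  · have hsplit : ∀ S : Set ℤ, (S ∩ Set.Ico (-((N + B : ℕ) : ℤ)) ((N + B : ℕ) : ℤ)).ncard =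
        (S ∩ F).ncard +
          ((S \ F) ∩ Set.Ico (-((N + B : ℕ) : ℤ)) ((N + B : ℕ) : ℤ)).ncard := by
      intro S
      rw [← Set.ncard_union_eq _ (hF.inter_of_right S) ((Set.finite_Ico _ _).inter_of_right _)]
      · congr 1
        ext m
        simp only [Set.mem_inter_iff, Set.mem_Ico, Set.mem_union, Set.mem_sdiff]
        constructor
        · rintro ⟨hm, h⟩
          by_cases hF' : m ∈ F
          · exact Or.inl ⟨hm, hF'⟩
          · exact Or.inr ⟨⟨hm, hF'⟩, h⟩
        · rintro (⟨hm, hF'⟩ | ⟨⟨hm, -⟩, h⟩)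
          · have := hB m hF'
            exact ⟨hm, by omega, by omega⟩
          · exact ⟨hm, h⟩
      · rw [Set.disjoint_left]
        rintro m ⟨-, h⟩ ⟨⟨-, h'⟩, -⟩
        exact h' h
    have hd : X \ F = Y \ F := by
      ext m
      simp only [Set.mem_sdiff]
      constructor
      · rintro ⟨a, b⟩; exact ⟨(hout m b).1 a, b⟩
      · rintro ⟨a, b⟩; exact ⟨(hout m b).2 a, b⟩
    rw [hsplit, ← hcard, ← hd, ← hsplit, hstep]

/-- Involutions of bounded displacement preserve the class of beta-sets. -/
theorem isBeta_image {X : Set ℤ} (hX : IsBeta X) (g : Perm ℤ) (hg : ∀ m, g (g m) = m)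
    (T : ℕ) (hT : ∀ m, |g m - m| ≤ T) : IsBeta (g '' X) := by
  have hmem : ∀ m, m ∈ g '' X ↔ g m ∈ X := by
    intro m
    constructor
    · rintro ⟨y, hy, rfl⟩; rwa [hg]
    · intro h; exact ⟨g m, h, hg m⟩
  have hX' := hX
  obtain ⟨N, h1, h2, -⟩ := hX'
  set I : Set ℤ := Set.Ico (-((N + T : ℕ) : ℤ)) ((N + T : ℕ) : ℤ) with hI
  have hIfin : I.Finite := Set.finite_Ico _ _
  refine isBeta_of_agree hX (I ∪ g '' I) (hIfin.union (hIfin.image g)) ?_ ?_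
  · intro m hm
    have hm1 : m ∉ I := fun h => hm (Or.inl h)
    have hm2 : g m ∉ I := fun h => hm (Or.inr ⟨g m, h, hg m⟩)
    have := abs_le.1 (hT m)
    simp only [hI, Set.mem_Ico, not_and_or, not_le, not_lt] at hm1 hm2
    rw [hmem]
    rcases hm1 with hm1 | hm1
    · have hX1 := h1 m (by omega)
      have hX2 := h1 (g m) (by omega)
      simp [hX1, hX2]
    · have hX1 := h2 m (by omega)
      have hX2 := h2 (g m) (by omega)
      simp [hX1, hX2]
  · have : (g '' X) ∩ (I ∪ g '' I) = g '' (X ∩ (I ∪ g '' I)) := by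
      rw [Set.image_inter g.injective, Set.image_union, ← Set.image_comp]
      have : (g ∘ g) '' I = I := by
        have : (g ∘ g : ℤ → ℤ) = id := funext hg
        rw [this, Set.image_id]
      rw [this, Set.union_comm]
    rw [this, Set.ncard_image_of_injective _ g.injective]

/-! ### The affine symmetric group -/

theorem periodic_mul {s : ℕ} {w : ℤ → ℤ} (hw : ∀ m, w (m + s) = w m + s) (m k : ℤ) :
    w (m + k * s) = w m + k * s := by
  have hn : ∀ (n : ℕ) (m : ℤ), w (m + n * s) = w m + n * s := by
    intro n
    induction n with
    | zero => simp
    | succ n ih =>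
      intro m
      have : m + ((n + 1 : ℕ) : ℤ) * s = (m + n * s) + s := by push_cast; ring
      rw [this, hw, ih]
      push_cast
      ring
  obtain ⟨n, rfl | rfl⟩ := k.eq_nat_or_neg
  · exact hn n m
  · have := hn n (m + -(n : ℤ) * s)
    rw [show m + -(n : ℤ) * s + n * s = m by ring] at this
    linarith

theorem periodic_sub_eq {s : ℕ} {w : ℤ → ℤ} (hw : ∀ m, w (m + s) = w m + s) {i j : ℤ}
    (h : (s : ℤ) ∣ i - j) : w i - i = w j - j := by
  obtain ⟨k, hk⟩ := h
  have : i = j + k * s := by linarith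
  rw [this, periodic_mul hw]
  ring

theorem sum_displacement {s : ℕ} {w : ℤ → ℤ} (v : Perm ℤ) (hw : ∀ m, w (m + s) = w m + s)
    (hv : ∀ m, v (m + s) = v m + s) :
    ∑ i ∈ Finset.range s, (w (v i) - v i) = ∑ i ∈ Finset.range s, (w i - i) := by
  have hmaps : Set.MapsTo (fun i : ℕ => (v i % s).toNat) (Finset.range s) (Finset.range s) := by
    intro i hi
    have hi' : i < s := by simpa using hi
    have h1 := Int.emod_nonneg (v i) (b := (s : ℤ)) (by omega)
    have h2 := Int.emod_lt_of_pos (v i) (b := (s : ℤ)) (by omega)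
    simp only [Finset.coe_range, Set.mem_Iio]
    omega
  have hinj : Set.InjOn (fun i : ℕ => (v i % s).toNat) (Finset.range s) := by
    intro i hi j hj h
    have hi' : i < s := by simpa using hi
    have hj' : j < s := by simpa using hj
    have h1 := Int.emod_nonneg (v i) (b := (s : ℤ)) (by omega)
    have h2 := Int.emod_nonneg (v j) (b := (s : ℤ)) (by omega)
    have h3 : v i % s = v j % s := by
      simp only at h
      omega
    obtain ⟨k, hk⟩ := Int.ModEq.dvd (n := (s : ℤ)) (a := v j) (b := v i) h3.symm
    have h4 : v (i : ℤ) = v ((j : ℤ) + k * s) := by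
      rw [periodic_mul hv]
      linarith
    have h5 := v.injective h4
    have h6 : (i : ℤ) % s = (j : ℤ) % s := by
      rw [h5, Int.add_mul_emod_self_right]
    rw [Int.emod_eq_of_lt (by omega) (by omega), Int.emod_eq_of_lt (by omega) (by omega)] at h6
    exact_mod_cast h6
  refine Finset.sum_nbij (fun i : ℕ => (v i % s).toNat) hmaps hinj
    (Finset.surjOn_of_injOn_of_card_le _ hmaps hinj le_rfl) ?_
  intro i hi
  have hi' : i < s := by simpa using hi
  have h1 := Int.emod_nonneg (v i) (b := (s : ℤ)) (by omega)
  apply periodic_sub_eq hw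
  rw [Int.toNat_of_nonneg h1]
  exact Int.dvd_self_sub_emod

theorem sum_range_choose (s : ℕ) : ∑ i ∈ Finset.range s, (i : ℤ) = (s.choose 2 : ℤ) := by
  rw [Nat.choose_two_right, ← Finset.sum_range_id]
  push_cast
  rfl

theorem sum_eq_choose_iff {s : ℕ} (w : ℤ → ℤ) :
    ∑ i ∈ Finset.range s, w i = (s.choose 2 : ℤ) ↔
      ∑ i ∈ Finset.range s, (w i - i) = 0 := by
  rw [Finset.sum_sub_distrib, sum_range_choose, sub_eq_zero]

theorem periodic_inv {s : ℕ} {w : Perm ℤ} (hw : ∀ m, w (m + s) = w m + s) (m : ℤ) :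
    w⁻¹ (m + s) = w⁻¹ m + s := by
  apply w.injective
  rw [hw]
  simp

/-- The affine symmetric group of degree `s`: the permutations `w` of `ℤ` with
`w (m + s) = w m + s` for all `m` and `w 0 + ⋯ + w (s - 1) = s.choose 2`. -/
def affineSymm (s : ℕ) : Subgroup (Perm ℤ) where
  carrier := {w | (∀ m, w (m + s) = w m + s) ∧
    ∑ i ∈ Finset.range s, w i = (s.choose 2 : ℤ)}
  one_mem' := ⟨fun _ => rfl, by simpa using sum_range_choose s⟩
  mul_mem' := by
    rintro w v ⟨hw, hw'⟩ ⟨hv, hv'⟩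
    refine ⟨fun m => by simp [hw, hv], ?_⟩
    rw [sum_eq_choose_iff] at *
    have := sum_displacement v hw hv
    rw [hw', Finset.sum_sub_distrib] at this
    rw [Finset.sum_sub_distrib] at *
    simp only [Perm.mul_apply]
    linarith
  inv_mem' := by
    rintro w ⟨hw, hw'⟩
    refine ⟨periodic_inv hw, ?_⟩
    rw [sum_eq_choose_iff] at *
    have := sum_displacement w⁻¹ hw (periodic_inv hw)
    rw [hw', Finset.sum_sub_distrib] at this
    rw [Finset.sum_sub_distrib]
    simp only [show ∀ k, w (w⁻¹ k) = k from w.apply_symm_apply] at this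
    linarith

theorem one_ne_zero_of_two_le {s : ℕ} (hs : 2 ≤ s) : (1 : ZMod s) ≠ 0 := by
  have : Fact (1 < s) := ⟨by omega⟩
  exact one_ne_zero

/-- The underlying function of the `i`-th Coxeter generator of the affine symmetric group. -/
def genFun (s : ℕ) (i : ZMod s) (m : ℤ) : ℤ :=
  if (m : ZMod s) = i - 1 then m + 1 else if (m : ZMod s) = i then m - 1 else m

theorem genFun_involutive {s : ℕ} (hs : 2 ≤ s) (i : ZMod s) :
    Function.Involutive (genFun s i) := by
  have h01 := one_ne_zero_of_two_le hs
  intro m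
  unfold genFun
  by_cases h1 : (m : ZMod s) = i - 1
  · have h2 : ((m + 1 : ℤ) : ZMod s) = i := by push_cast; rw [h1]; ring
    have h3 : i ≠ i - 1 := by
      intro h
      exact h01 (by linear_combination h)
    simp [h1, h3]
  · by_cases h2 : (m : ZMod s) = i
    · have h3 : i ≠ i - 1 := by rwa [h2] at h1
      simp [h2, h3]
    · simp [h1, h2]

theorem genFun_mem {s : ℕ} (hs : 2 ≤ s) (i : ZMod s) :
    (genFun_involutive hs i).toPerm (genFun s i) ∈ affineSymm s := by
  have : NeZero s := ⟨by omega⟩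
  have h01 := one_ne_zero_of_two_le hs
  constructor
  · intro m
    simp only [Function.Involutive.coe_toPerm, genFun, Int.cast_add, Int.cast_natCast,
      CharP.cast_eq_zero, add_zero]
    split_ifs <;> ring
  · rw [sum_eq_choose_iff]
    have hone : ∀ a : ZMod s,
        ∑ m ∈ Finset.range s, (if ((m : ℕ) : ZMod s) = a then (1 : ℤ) else 0) = 1 := by
      intro a
      rw [Finset.sum_eq_single a.val]
      · simp
      · intro b hb hne
        rw [if_neg]
        rintro rfl
        exact hne (ZMod.val_cast_of_lt (Finset.mem_range.1 hb)).symm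
      · intro h
        exact absurd (Finset.mem_range.2 (ZMod.val_lt a)) h
    have : ∀ m ∈ Finset.range s,
        (genFun_involutive hs i).toPerm (genFun s i) (m : ℤ) - m =
          (if ((m : ℕ) : ZMod s) = i - 1 then (1 : ℤ) else 0) -
            (if ((m : ℕ) : ZMod s) = i then (1 : ℤ) else 0) := by
      intro m _
      simp only [Function.Involutive.coe_toPerm, genFun, Int.cast_natCast]
      by_cases h1 : ((m : ℕ) : ZMod s) = i - 1
      · have h2 : ((m : ℕ) : ZMod s) ≠ i := by
          intro h
          exact h01 (by linear_combination h1 - h)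
        simp only [if_pos h1, if_neg h2]
        ring
      · by_cases h2 : ((m : ℕ) : ZMod s) = i
        · simp only [if_neg h1, if_pos h2]
          ring
        · simp only [if_neg h1, if_neg h2]
          ring
    rw [Finset.sum_congr rfl this, Finset.sum_sub_distrib, hone, hone, sub_self]

/-- The Coxeter generator `w_i` of the affine symmetric group, for `i ∈ ℤ/sℤ`: it adds `1` to
the integers in the class `i - 1` and subtracts `1` from the integers in the class `i`. -/
def gen {s : ℕ} (hs : 2 ≤ s) (i : ZMod s) : affineSymm s :=
  ⟨(genFun_involutive hs i).toPerm (genFun s i), genFun_mem hs i⟩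

/-! ### The affine hyperoctahedral group -/

open Classical in
/-- The generators `v_i` of the affine hyperoctahedral group, with `u = s / 2` (rounded down):
`w_i` if `i = 0`, `w_i w_{-i}` if `i = ± l` with `1 ≤ l < u`, and `w_i w_{-i} w_i` in the
remaining case `i = ± u`. -/
noncomputable def hypGen {s : ℕ} (hs : 2 ≤ s) (i : ZMod s) : affineSymm s :=
  if i = 0 then gen hs i
  else if ∃ l : ℕ, 1 ≤ l ∧ l < s / 2 ∧ (i = (l : ZMod s) ∨ i = -(l : ZMod s)) then
    gen hs i * gen hs (-i)
  else gen hs i * gen hs (-i) * gen hs i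

/-- The affine hyperoctahedral group of degree `s / 2` (rounded down), as a subgroup of the
affine symmetric group of degree `s`. -/
def hyp {s : ℕ} (hs : 2 ≤ s) : Subgroup (affineSymm s) :=
  Subgroup.closure (Set.range (hypGen hs))

/-! ### The level `t` action -/

/-- The integer `(s - 1)(t - 1) / 2`; the division is exact for coprime `s` and `t`. -/
def shift (s t : ℕ) : ℤ := ((s : ℤ) - 1) * ((t : ℤ) - 1) / 2

/-- The level `t` action of `w` on `ℤ` in closed form: `m ↦ m + t (w i - i)`, where `i` is any
integer with `i t ≡ m + (s - 1)(t - 1) / 2` modulo `s` (here one is chosen by Bézout). The values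
on the generators `w_i` are computed in `levelHom_gen`. -/
def levelFun (s t : ℕ) (w : ℤ → ℤ) (m : ℤ) : ℤ :=
  m + t * (w ((m + shift s t) * Nat.gcdB s t) - (m + shift s t) * Nat.gcdB s t)

theorem gcdB_spec {s t : ℕ} (hst : s.Coprime t) (a : ℤ) :
    (s : ℤ) ∣ a * Nat.gcdB s t * t - a := by
  have h := Nat.gcd_eq_gcd_ab s t
  rw [hst.gcd_eq_one] at h
  push_cast at h
  exact ⟨-a * Nat.gcdA s t, by linear_combination -a * h⟩

theorem levelFun_eq {s t : ℕ} (hst : s.Coprime t) {w : ℤ → ℤ}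
    (hw : ∀ m, w (m + s) = w m + s) {m i : ℤ} (hi : (s : ℤ) ∣ i * t - (m + shift s t)) :
    levelFun s t w m = m + t * (w i - i) := by
  unfold levelFun
  rw [periodic_sub_eq hw (i := (m + shift s t) * Nat.gcdB s t) (j := i)]
  have h := dvd_sub (gcdB_spec hst (m + shift s t)) hi
  have h' : (s : ℤ) ∣ ((m + shift s t) * Nat.gcdB s t - i) * t := by
    rwa [show (m + shift s t) * Nat.gcdB s t * t - (m + shift s t) -
      (i * t - (m + shift s t)) = ((m + shift s t) * Nat.gcdB s t - i) * t by ring] at h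
  exact (Int.isCoprime_iff_gcd_eq_one.2 (by simpa using hst)).dvd_of_dvd_mul_right h'

theorem levelFun_comp {s t : ℕ} (hst : s.Coprime t) {w v : ℤ → ℤ}
    (hw : ∀ m, w (m + s) = w m + s) (hv : ∀ m, v (m + s) = v m + s) (m : ℤ) :
    levelFun s t (w ∘ v) m = levelFun s t w (levelFun s t v m) := by
  set i := (m + shift s t) * Nat.gcdB s t with hi
  have h := gcdB_spec hst (m + shift s t)
  rw [← hi] at h
  rw [levelFun_eq hst (w := w ∘ v) (i := i) (fun m => by simp [hw, hv]) h,
    levelFun_eq hst hv h, levelFun_eq hst hw (i := v i)]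
  · change m + t * (w (v i) - i) = m + t * (v i - i) + t * (w (v i) - v i)
    ring
  · rwa [show v i * t - (m + t * (v i - i) + shift s t) = i * t - (m + shift s t) by ring]

theorem levelFun_id (s t : ℕ) (m : ℤ) : levelFun s t id m = m := by
  simp [levelFun]

/-- The level `t` action of the affine symmetric group on `ℤ`. -/
def levelHom {s t : ℕ} (hst : s.Coprime t) : affineSymm s →* Perm ℤ where
  toFun w :=
    { toFun := levelFun s t (w : Perm ℤ)
      invFun := levelFun s t ((w⁻¹ : affineSymm s) : Perm ℤ)
      left_inv := fun m => by
        rw [← levelFun_comp hst (w⁻¹).2.1 w.2.1]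
        convert levelFun_id s t m using 2
        funext k
        simp
      right_inv := fun m => by
        rw [← levelFun_comp hst w.2.1 (w⁻¹).2.1]
        convert levelFun_id s t m using 2
        funext k
        simp }
  map_one' := by
    ext m
    exact levelFun_id s t m
  map_mul' w v := by
    ext m
    exact levelFun_comp hst w.2.1 v.2.1 m

/-- On the generators, the level `t` action is given by the usual defining formula: `w_i` adds
`t` to the class `(i - 1) t - c` and subtracts `t` from the class `i t - c`, with
`c = (s - 1)(t - 1) / 2`. -/
theorem levelHom_gen {s t : ℕ} (hs : 2 ≤ s) (hst : s.Coprime t) (i : ZMod s) (m : ℤ) :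
    levelHom hst (gen hs i) m =
      if (m : ZMod s) = (i - 1) * t - (shift s t : ZMod s) then m + t
      else if (m : ZMod s) = i * t - (shift s t : ZMod s) then m - t
      else m := by
  set k := (m + shift s t) * Nat.gcdB s t with hk
  have h := gcdB_spec hst (m + shift s t)
  rw [← hk] at h
  have h1 : levelHom hst (gen hs i) m = m + t * (genFun s i k - k) :=
    levelFun_eq hst (gen hs i).2.1 h
  have hu : IsUnit ((t : ℕ) : ZMod s) := (ZMod.isUnit_iff_coprime t s).2 hst.symm
  have h2 : (k : ZMod s) * t = m + shift s t := by
    have := (ZMod.intCast_zmod_eq_zero_iff_dvd _ _).2 h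
    push_cast at this
    linear_combination this
  have h3 : ∀ j : ZMod s, (k : ZMod s) = j ↔ (m : ZMod s) = j * t - (shift s t : ZMod s) := by
    intro j
    rw [eq_sub_iff_add_eq, ← h2, hu.mul_left_inj]
  rw [h1, genFun]
  simp only [h3]
  split_ifs <;> ring

/-- The permutations of `ℤ` which permute the beta-sets. -/
def betaPreserving : Subgroup (Perm ℤ) where
  carrier := {g | ∀ X : Set ℤ, IsBeta (g '' X) ↔ IsBeta X}
  one_mem' := fun X => by simp
  mul_mem' := fun {g h} hg hh X => by
    rw [Perm.coe_mul, Set.image_comp, hg, hh]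
  inv_mem' := fun {g} hg X => by
    have h : g '' (⇑(g⁻¹) '' X) = X := by
      rw [← Set.image_comp, ← Perm.coe_mul, mul_inv_cancel, Perm.coe_one, Set.image_id]
    rw [← hg (⇑(g⁻¹) '' X), h]

theorem gen_mul_self {s : ℕ} (hs : 2 ≤ s) (i : ZMod s) : gen hs i * gen hs i = 1 := by
  ext m
  exact genFun_involutive hs i m

theorem levelHom_gen_mem {s t : ℕ} (hs : 2 ≤ s) (hst : s.Coprime t) (i : ZMod s) :
    levelHom hst (gen hs i) ∈ betaPreserving := by
  have hinv : ∀ m, levelHom hst (gen hs i) (levelHom hst (gen hs i) m) = m := by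
    intro m
    rw [← Perm.mul_apply, ← map_mul, gen_mul_self, map_one, Perm.one_apply]
  have hT : ∀ m, |levelHom hst (gen hs i) m - m| ≤ (t : ℕ) := by
    intro m
    rw [levelHom_gen]
    split_ifs <;> simp
  intro X
  refine ⟨fun h => ?_, fun h => isBeta_image h _ hinv t hT⟩
  have := isBeta_image h _ hinv t hT
  rwa [← Set.image_comp, show (levelHom hst (gen hs i) ∘ levelHom hst (gen hs i) : ℤ → ℤ) = id
    from funext hinv, Set.image_id] at this

theorem levelHom_hyp_mem {s t : ℕ} (hs : 2 ≤ s) (hst : s.Coprime t) (w : hyp hs) :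
    levelHom hst w ∈ betaPreserving := by
  have h : hyp hs ≤ betaPreserving.comap (levelHom hst) := by
    refine (Subgroup.closure_le _).2 ?_
    rintro _ ⟨i, rfl⟩
    have hg : ∀ j, gen hs j ∈ betaPreserving.comap (levelHom hst) :=
      levelHom_gen_mem hs hst
    unfold hypGen
    split_ifs
    · exact hg i
    · exact mul_mem (hg i) (hg _)
    · exact mul_mem (mul_mem (hg i) (hg _)) (hg i)
  exact h w.2

theorem exists_levelAct {s t : ℕ} (hs : 2 ≤ s) (hst : s.Coprime t) (w : hyp hs)
    (μ : YoungDiagram) : ∃ ν, betaSet ν = levelHom hst w '' betaSet μ :=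
  exists_betaSet ((levelHom_hyp_mem hs hst w _).2 (isBeta_betaSet μ))

/-- The partition whose beta-set is the image of the beta-set of `μ` under the level `t` action
of `w` on `ℤ`. -/
noncomputable def levelAct {s t : ℕ} (hs : 2 ≤ s) (hst : s.Coprime t) (w : hyp hs)
    (μ : YoungDiagram) : YoungDiagram :=
  (exists_levelAct hs hst w μ).choose

theorem betaSet_levelAct {s t : ℕ} (hs : 2 ≤ s) (hst : s.Coprime t) (w : hyp hs)
    (μ : YoungDiagram) : betaSet (levelAct hs hst w μ) = levelHom hst w '' betaSet μ :=
  (exists_levelAct hs hst w μ).choose_spec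

/-- The level `t` action of the affine hyperoctahedral group on partitions. -/
@[reducible]
noncomputable def levelAction {s t : ℕ} (hs : 2 ≤ s) (hst : s.Coprime t) :
    MulAction (hyp hs) YoungDiagram where
  smul := levelAct hs hst
  one_smul μ := betaSet_injective <| by
    change betaSet (levelAct hs hst 1 μ) = _
    rw [betaSet_levelAct]
    simp
  mul_smul w v μ := betaSet_injective <| by
    change betaSet (levelAct hs hst (w * v) μ) =
      betaSet (levelAct hs hst w (levelAct hs hst v μ))
    rw [betaSet_levelAct, betaSet_levelAct, betaSet_levelAct, ← Set.image_comp, ← Perm.coe_mul,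
      ← map_mul, Subgroup.coe_mul]

/-- The stabiliser of `μ` under the level `t` action of the affine hyperoctahedral group. -/
noncomputable def stabSC {s t : ℕ} (hs : 2 ≤ s) (hst : s.Coprime t) (μ : YoungDiagram) :
    Subgroup (hyp hs) :=
  letI := levelAction hs hst
  MulAction.stabilizer (hyp hs) μ

end CoreAction

namespace CoreAction

/-! ### Hook lengths and beta-sets -/

/-! Write `c = shift s t`. Since `s` and `t` are coprime, every integer is `t * i - c - s * k`, with
`(i, k)` unique up to multiples of `(s, t)`. A beta-set closed under subtracting `s` is described by
thresholds `h i`: the integer belongs to it iff `h i ≤ k`. The ambiguity of coordinates gives `h (i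
+ s) = h i + t`, self-conjugacy becomes `h (-1 - i) = 2 - t - h i`, and being a `t`-core becomes
monotonicity of `h` (`bijOn_abacusDiagram`). The level `t` action moves only `i`, so `w` fixes the
core iff `h ∘ w = h` (`mem_stabSC_iff`). What remains is a weighted count of monotone symmetric
quasi-periodic functions.

Each orbit under precomposition contains exactly one monotone function. Existence is bubble sort
with the generators `v_i`, controlled by a quadratic energy (`IsQuasi.exists_monotone`); uniqueness
is a pigeonhole argument on a symmetric interval (`IsQuasi.comp_eq_of_monotone`). Sorting also shows
that the `v_i` generate all symmetric quasi-periodic bijections (`IsQuasi.exists_hyp`).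

With `u = s / 2`, the box of functions with values in `[0, t)` on `0, ..., u - 1` has `t ^ u`
elements. For any `m`, exactly `2 ^ u * u!` group elements carry `m` into the box: the induced
permutation of residues can be any one commuting with `x ↦ -1 - x`, and the box then fixes the
translation part (`card_boxMovers`). Hence `|Stab m| * |orbit ∩ box| = 2 ^ u * u!`. Summing `1 /
|Stab m|` over sorted `m` counts the box orbit by orbit. -/

/-- The complement of the beta-set is enumerated by the columns. -/
def gapFun (μ : YoungDiagram) (j : ℕ) : ℤ := (j : ℤ) - μ.colLen j

theorem mem_iff_gapFun_lt (μ : YoungDiagram) (i j : ℕ) :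
    (i, j) ∈ μ ↔ gapFun μ j < betaFun μ i := by
  have h1 := YoungDiagram.mem_iff_lt_rowLen (μ := μ) (i := i) (j := j)
  have h2 := YoungDiagram.mem_iff_lt_colLen (μ := μ) (i := i) (j := j)
  unfold gapFun betaFun
  by_cases h : (i, j) ∈ μ
  · have := h1.1 h
    have := h2.1 h
    exact ⟨fun _ => by omega, fun _ => h⟩
  · have := mt h1.2 h
    have := mt h2.2 h
    exact ⟨fun h' => absurd h' h, fun h' => by omega⟩

theorem betaFun_ne_gapFun (μ : YoungDiagram) (i j : ℕ) : betaFun μ i ≠ gapFun μ j := by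
  have h1 := YoungDiagram.mem_iff_lt_rowLen (μ := μ) (i := i) (j := j)
  have h2 := YoungDiagram.mem_iff_lt_colLen (μ := μ) (i := i) (j := j)
  unfold gapFun betaFun
  by_cases h : (i, j) ∈ μ
  · have := h1.1 h
    have := h2.1 h
    omega
  · have := mt h1.2 h
    have := mt h2.2 h
    omega

/-- If `i` beta-numbers exceed a missed integer `m`, then column `m + i` has length `i`, and its gap
is `m`. -/
theorem notMem_betaSet_iff (μ : YoungDiagram) (m : ℤ) :
    m ∉ betaSet μ ↔ ∃ j, gapFun μ j = m := by
  classical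
  constructor
  · intro hm
    have hex : ∃ i : ℕ, betaFun μ i ≤ m := by
      refine ⟨μ.rowLen 0 + m.natAbs, ?_⟩
      have := μ.rowLen_anti 0 (μ.rowLen 0 + m.natAbs) (Nat.zero_le _)
      unfold betaFun
      omega
    set i := Nat.find hex with hi
    have h1 : betaFun μ i ≤ m := Nat.find_spec hex
    have h2 : betaFun μ i ≠ m := fun h => hm ⟨i, h⟩
    have h3 : ∀ k < i, m < betaFun μ k := fun k hk => not_le.1 (Nat.find_min hex hk)
    obtain ⟨j, hj⟩ : ∃ j : ℕ, (j : ℤ) = m + i := by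
      refine ⟨(m + i).toNat, ?_⟩
      unfold betaFun at h1 h2
      omega
    refine ⟨j, ?_⟩
    have hc : μ.colLen j = i := by
      refine eq_of_forall_lt_iff fun k => ?_
      rw [← YoungDiagram.mem_iff_lt_colLen, YoungDiagram.mem_iff_lt_rowLen]
      constructor
      · intro h
        by_contra h'
        have := μ.rowLen_anti i k (not_lt.1 h')
        unfold betaFun at h1 h2
        omega
      · intro h
        have h4 := h3 (i - 1) (by omega)
        have := μ.rowLen_anti k (i - 1) (by omega)
        unfold betaFun at h4
        omega
    unfold gapFun
    omega
  · rintro ⟨j, rfl⟩ ⟨i, hi⟩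
    exact betaFun_ne_gapFun μ i j hi

theorem hookLength_eq {μ : YoungDiagram} {c : ℕ × ℕ} (hc : c ∈ μ.cells) :
    (hookLength μ c : ℤ) = betaFun μ c.1 - gapFun μ c.2 := by
  obtain ⟨i, j⟩ := c
  have h1 := (YoungDiagram.mem_iff_lt_rowLen (μ := μ)).1 hc
  have h2 := (YoungDiagram.mem_iff_lt_colLen (μ := μ)).1 hc
  simp only [hookLength, betaFun, gapFun]
  omega

/-- Hook lengths are the positive differences of a beta-number and a gap, so a hook of length `s` is
a beta-number whose translate by `-s` is a gap. -/
theorem isCore_iff {s : ℕ} (hs : 0 < s) (μ : YoungDiagram) :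
    IsCore s μ ↔ ∀ m ∈ betaSet μ, m - s ∈ betaSet μ := by
  constructor
  · rintro h _ ⟨i, rfl⟩
    by_contra hm
    obtain ⟨j, hj⟩ := (notMem_betaSet_iff μ _).1 hm
    have hc : (i, j) ∈ μ := (mem_iff_gapFun_lt μ i j).2 (by omega)
    have := hookLength_eq hc
    refine h (i, j) hc ?_
    simp only at this
    omega
  · intro h c hc hcs
    have h1 := hookLength_eq hc
    refine (notMem_betaSet_iff μ _).2 ⟨c.2, ?_⟩ (h _ ⟨c.1, rfl⟩)
    omega

theorem mem_betaSet_transpose (μ : YoungDiagram) (m : ℤ) :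
    m ∈ betaSet μ.transpose ↔ -1 - m ∉ betaSet μ := by
  rw [notMem_betaSet_iff]
  refine exists_congr fun i => ?_
  simp only [betaFun, gapFun, YoungDiagram.rowLen_transpose]
  omega

theorem isSelfConj_iff (μ : YoungDiagram) :
    IsSelfConj μ ↔ ∀ m, m ∈ betaSet μ ↔ -1 - m ∉ betaSet μ := by
  simp only [← mem_betaSet_transpose]
  exact ⟨fun h m => by rw [h], fun h => betaSet_injective (Set.ext fun m => (h m).symm)⟩

/-- Bounded sets with the symmetry of self-conjugate partitions are beta-sets. -/
theorem isBeta_of_symm {X : Set ℤ} (N : ℕ) (hN : ∀ m : ℤ, m < -N → m ∈ X)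
    (hX : ∀ m, m ∈ X ↔ -1 - m ∉ X) : IsBeta X := by
  refine ⟨N, hN, fun m hm => ?_, ?_⟩
  · intro h
    exact (hX m).1 h (hN _ (by omega))
  · have hfin : (Set.Ico (-(N : ℤ)) N).Finite := Set.finite_Ico _ _
    -- The reflection preserves the window of `2 * N` integers and exchanges `X` with its complement
    -- there, so each has `N` elements.
    have h1 : ((fun m : ℤ => -1 - m) '' (X ∩ Set.Ico (-(N : ℤ)) N)) =
        Set.Ico (-(N : ℤ)) N \ X := by
      ext m
      simp only [Set.mem_image, Set.mem_inter_iff, Set.mem_Ico, Set.mem_sdiff]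
      constructor
      · rintro ⟨k, ⟨hk, h2, h3⟩, rfl⟩
        exact ⟨by omega, (hX k).1 hk⟩
      · rintro ⟨h2, h3⟩
        refine ⟨-1 - m, ⟨(hX _).2 ?_, by omega⟩, by ring⟩
        rwa [sub_sub_cancel]
    have h2 : (X ∩ Set.Ico (-(N : ℤ)) N).ncard = (Set.Ico (-(N : ℤ)) N \ X).ncard := by
      rw [← h1, Set.ncard_image_of_injective _ sub_right_injective]
    have h3 := Set.ncard_inter_add_ncard_sdiff_eq_ncard (Set.Ico (-(N : ℤ)) N) X hfin
    rw [Set.inter_comm, ← h2, ← Finset.coe_Ico, Set.ncard_coe_finset, Int.card_Ico] at h3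
    rw [← Finset.coe_Ico]
    omega

/-! ### Symmetric quasi-periodic functions -/

/-- Quasi-periodic functions on `ℤ` which are symmetric with respect to `i ↦ -1 - i`. -/
def IsQuasi (s : ℕ) (T C : ℤ) (h : ℤ → ℤ) : Prop :=
  (∀ i, h (i + s) = h i + T) ∧ ∀ i, h (-1 - i) = C - h i

theorem quasi_add_mul {s : ℕ} {T : ℤ} {h : ℤ → ℤ} (hh : ∀ i, h (i + s) = h i + T) (i k : ℤ) :
    h (i + s * k) = h i + T * k := by
  induction k using Int.induction_on with
  | zero => simp
  | succ k ih => rw [show i + s * ((k : ℤ) + 1) = i + s * k + s by ring, hh, ih]; ring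
  | pred k ih =>
    have := hh (i + s * (-(k : ℤ) - 1))
    rw [show i + s * (-(k : ℤ) - 1) + s = i + s * -k by ring, ih] at this
    linarith

theorem IsQuasi.comp {s : ℕ} {T C : ℤ} {h w : ℤ → ℤ} (hh : IsQuasi s T C h)
    (hw : IsQuasi s s (-1) w) : IsQuasi s T C (h ∘ w) :=
  ⟨fun i => by simp only [Function.comp, hw.1, hh.1],
    fun i => by simp only [Function.comp, hw.2, hh.2]⟩

/-! ### The generators -/

theorem not_dvd_of_lt {s : ℕ} {a : ℤ} (h1 : 0 < a) (h2 : a < s) : ¬ (s : ℤ) ∣ a :=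
  fun h => absurd (Int.le_of_dvd h1 h) (by omega)

theorem gen_apply_self {s : ℕ} (hs : 2 ≤ s) (i : ℤ) :
    (gen hs (i : ZMod s) : Perm ℤ) i = i - 1 := by
  have h01 := one_ne_zero_of_two_le hs
  change genFun s _ i = _
  rw [genFun, if_neg, if_pos rfl]
  intro h
  exact h01 (by linear_combination h)

theorem gen_apply_sub_one {s : ℕ} (hs : 2 ≤ s) (i : ℤ) :
    (gen hs (i : ZMod s) : Perm ℤ) (i - 1) = i := by
  change genFun s _ (i - 1) = _
  rw [genFun, if_pos (by push_cast; ring)]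
  ring

theorem gen_apply_of_not_dvd {s : ℕ} (hs : 2 ≤ s) {i j : ℤ} (h1 : ¬ (s : ℤ) ∣ j - i)
    (h2 : ¬ (s : ℤ) ∣ j - i + 1) : (gen hs (i : ZMod s) : Perm ℤ) j = j := by
  change genFun s _ j = _
  rw [← ZMod.intCast_zmod_eq_zero_iff_dvd] at h1 h2
  push_cast at h1 h2
  rw [genFun, if_neg, if_neg]
  · exact fun h => h1 (by rw [h]; ring)
  · exact fun h => h2 (by rw [h]; ring)

theorem gen_apply_reflect {s : ℕ} (hs : 2 ≤ s) (i : ZMod s) (m : ℤ) :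
    (gen hs i : Perm ℤ) (-1 - m) = -1 - (gen hs (-i) : Perm ℤ) m := by
  change genFun s i (-1 - m) = -1 - genFun s (-i) m
  have h1 : ((-1 - m : ℤ) : ZMod s) = i - 1 ↔ (m : ZMod s) = -i := by
    push_cast
    constructor <;> intro h <;> linear_combination -h
  have h2 : ((-1 - m : ℤ) : ZMod s) = i ↔ (m : ZMod s) = -i - 1 := by
    push_cast
    constructor <;> intro h <;> linear_combination -h
  have h01 := one_ne_zero_of_two_le hs
  unfold genFun
  simp only [h1, h2]
  by_cases h3 : (m : ZMod s) = -i
  · have h4 : ¬ (-i = -i - 1) := fun h => h01 (by linear_combination h)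
    simp only [h3, h4, if_true, if_false]
    ring
  · simp only [h3, if_false]
    split_ifs <;> ring

theorem gen_apply_fix {s : ℕ} (hs : 2 ≤ s) {i : ZMod s} {m : ℤ} (h1 : (m : ZMod s) ≠ i - 1)
    (h2 : (m : ZMod s) ≠ i) : (gen hs i : Perm ℤ) m = m := by
  change genFun s i m = m
  rw [genFun, if_neg h1, if_neg h2]

/-- The hypotheses say that the classes `i - 1, i` exchanged by `w_i` are disjoint from the classes
`j - 1, j` exchanged by `w_j`. -/
theorem gen_fix_of_move {s : ℕ} (hs : 2 ≤ s) {i j : ZMod s} (h1 : i ≠ j) (h2 : i ≠ j + 1)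
    (h3 : j ≠ i + 1) {m : ℤ} (hm : (gen hs i : Perm ℤ) m ≠ m) :
    (gen hs j : Perm ℤ) m = m ∧
      (gen hs j : Perm ℤ) ((gen hs i : Perm ℤ) m) = (gen hs i : Perm ℤ) m := by
  by_cases a : (m : ZMod s) = i - 1
  · obtain rfl : i = ((m + 1 : ℤ) : ZMod s) := by push_cast; rw [a]; ring
    have e : (gen hs ((m + 1 : ℤ) : ZMod s) : Perm ℤ) m = m + 1 := by
      simpa using gen_apply_sub_one hs (m + 1)
    push_cast at h1 h2 h3
    rw [e]
    refine ⟨gen_apply_fix hs ?_ ?_, gen_apply_fix hs ?_ ?_⟩ <;> push_cast <;> intro h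
    · exact h1 (by linear_combination h)
    · exact h2 (by linear_combination h)
    · exact h3 (by linear_combination -h)
    · exact h1 (by linear_combination h)
  · by_cases b : (m : ZMod s) = i
    · subst b
      rw [gen_apply_self]
      refine ⟨gen_apply_fix hs ?_ ?_, gen_apply_fix hs ?_ ?_⟩ <;> push_cast <;> intro h
      · exact h3 (by linear_combination -h)
      · exact h1 h
      · exact h1 (by linear_combination h)
      · exact h2 (by linear_combination h)
    · exact absurd (gen_apply_fix hs a b) hm

theorem gen_comm {s : ℕ} (hs : 2 ≤ s) {i j : ZMod s} (h1 : i ≠ j) (h2 : i ≠ j + 1)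
    (h3 : j ≠ i + 1) : gen hs i * gen hs j = gen hs j * gen hs i := by
  ext m
  simp only [Subgroup.coe_mul, Perm.mul_apply]
  by_cases a : (gen hs i : Perm ℤ) m = m
  · by_cases b : (gen hs j : Perm ℤ) m = m
    · rw [b, a, b]
    · rw [a, (gen_fix_of_move hs h1.symm h3 h2 b).2]
  · rw [(gen_fix_of_move hs h1 h2 h3 a).2, (gen_fix_of_move hs h1 h2 h3 a).1]

theorem gen_braid {s : ℕ} (hs : 3 ≤ s) (i : ZMod s) :
    gen (by omega : 2 ≤ s) i * gen (by omega) (i + 1) * gen (by omega) i =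
      gen (by omega) (i + 1) * gen (by omega) i * gen (by omega) (i + 1) := by
  have hs2 : 2 ≤ s := by omega
  have up : ∀ n : ℤ, (gen hs2 ((n + 1 : ℤ) : ZMod s) : Perm ℤ) n = n + 1 := fun n => by
    simpa using gen_apply_sub_one hs2 (n + 1)
  have fixr : ∀ n : ℤ, (gen hs2 (n : ZMod s) : Perm ℤ) (n + 1) = n + 1 := fun n =>
    gen_apply_of_not_dvd hs2 (not_dvd_of_lt (by omega) (by omega))
      (not_dvd_of_lt (by omega) (by omega))
  have fixl : ∀ n : ℤ, (gen hs2 ((n + 1 : ℤ) : ZMod s) : Perm ℤ) (n - 1) = n - 1 := fun n => by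
    apply gen_apply_of_not_dvd hs2 <;> rw [← dvd_neg] <;>
      exact not_dvd_of_lt (by omega) (by omega)
  have upl : ∀ n : ℤ, (gen hs2 (n : ZMod s) : Perm ℤ) (n - 1) = n := gen_apply_sub_one hs2
  have down : ∀ n : ℤ, (gen hs2 (n : ZMod s) : Perm ℤ) n = n - 1 := gen_apply_self hs2
  have downr : ∀ n : ℤ, (gen hs2 ((n + 1 : ℤ) : ZMod s) : Perm ℤ) (n + 1) = n := fun n => by
    simpa using gen_apply_self hs2 (n + 1)
  -- Both sides exchange `n - 1` and `n + 1` and fix `n`.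
  have key : ∀ n m : ℤ, m = n - 1 ∨ m = n ∨ m = n + 1 →
      (gen hs2 (n : ZMod s) : Perm ℤ) ((gen hs2 ((n + 1 : ℤ) : ZMod s) : Perm ℤ)
        ((gen hs2 (n : ZMod s) : Perm ℤ) m)) =
      (gen hs2 ((n + 1 : ℤ) : ZMod s) : Perm ℤ) ((gen hs2 (n : ZMod s) : Perm ℤ)
        ((gen hs2 ((n + 1 : ℤ) : ZMod s) : Perm ℤ) m)) := by
    rintro n m (rfl | rfl | rfl)
    · rw [upl, up, fixr, fixl, upl, up]
    · rw [down, fixl, upl, up, fixr, downr]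
    · rw [fixr, downr, down, fixl]
  ext m
  simp only [Subgroup.coe_mul, Perm.mul_apply]
  by_cases a : (m : ZMod s) = i - 1
  · obtain rfl : i = ((m + 1 : ℤ) : ZMod s) := by push_cast; rw [a]; ring
    simpa using key (m + 1) m (by omega)
  · by_cases b : (m : ZMod s) = i
    · subst b
      simpa using key m m (by omega)
    · by_cases c : (m : ZMod s) = i + 1
      · obtain rfl : i = ((m - 1 : ℤ) : ZMod s) := by push_cast; rw [c]; ring
        have := key (m - 1) m (by omega)
        push_cast at this ⊢
        exact this
      · have h1 := gen_apply_fix hs2 a b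
        have h2 := gen_apply_fix hs2 (i := i + 1) (by rwa [add_sub_cancel_right]) c
        simp only [h1, h2]

/-- Conjugation by the reflection turns `w_i` into `w_{-i}`. The product `v_i` survives this because
`w_i` and `w_{-i}` commute when `1 ≤ l < u`, and coincide or satisfy the braid relation when `i = ±
u`. -/
theorem hypGen_reflect {s : ℕ} (hs : 2 ≤ s) (i : ZMod s) (m : ℤ) :
    (hypGen hs i : Perm ℤ) (-1 - m) = -1 - (hypGen hs i : Perm ℤ) m := by
  have hdvd : ∀ k : ℤ, (k : ZMod s) = 0 → (s : ℤ) ∣ k := fun k hk =>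
    (ZMod.intCast_zmod_eq_zero_iff_dvd _ _).1 hk
  unfold hypGen
  split_ifs with h0 hl
  · rw [gen_apply_reflect, h0, neg_zero]
  · have hc : gen hs (-i) * gen hs i = gen hs i * gen hs (-i) := by
      obtain ⟨l, hl1, hl2, hl⟩ := hl
      have e1 : ((2 * l : ℤ) : ZMod s) ≠ 0 := fun h =>
        not_dvd_of_lt (by omega) (by omega) (hdvd _ h)
      have e2 : ((2 * l + 1 : ℤ) : ZMod s) ≠ 0 := fun h =>
        not_dvd_of_lt (by omega) (by omega) (hdvd _ h)
      have e3 : ((2 * l - 1 : ℤ) : ZMod s) ≠ 0 := fun h =>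
        not_dvd_of_lt (by omega) (by omega) (hdvd _ h)
      push_cast at e1 e2 e3
      rcases hl with rfl | rfl
      · refine gen_comm hs (fun h => e1 ?_) (fun h => e2 ?_) fun h => e3 ?_
        · linear_combination -h
        · linear_combination -h
        · linear_combination h
      · refine gen_comm hs (fun h => e1 ?_) (fun h => e3 ?_) fun h => e2 ?_
        · linear_combination h
        · linear_combination h
        · linear_combination -h
    have := congrArg (fun w : affineSymm s => (w : Perm ℤ) m) hc
    simp only [Subgroup.coe_mul, Perm.mul_apply] at this ⊢
    rw [gen_apply_reflect, gen_apply_reflect, neg_neg, this]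
  · have hb : gen hs (-i) * gen hs i * gen hs (-i) = gen hs i * gen hs (-i) * gen hs i := by
      have : NeZero s := ⟨by omega⟩
      have hv := ZMod.val_lt i
      have hv0 : 0 < i.val := Nat.pos_of_ne_zero ((ZMod.val_ne_zero i).2 h0)
      have hcast : ((i.val : ℕ) : ZMod s) = i := ZMod.natCast_zmod_val i
      have h1 : ¬ i.val < s / 2 := fun h => hl ⟨i.val, hv0, h, Or.inl hcast.symm⟩
      have h2 : ¬ s - i.val < s / 2 := fun h => hl ⟨s - i.val, by omega, h, Or.inr (by
        rw [Nat.cast_sub hv.le, hcast]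
        simp)⟩
      have hz : ∀ k : ℕ, k = s → (k : ZMod s) = 0 := by
        rintro _ rfl
        simp
      -- The representative of `i` is as close to `s / 2` as possible, so `-i` is `i`, `i + 1` or `i
      -- - 1`.
      obtain h | h | h : i.val + i.val = s ∨ i.val + i.val + 1 = s ∨ i.val + i.val = s + 1 := by
        omega
      · have := hz _ h
        push_cast at this
        rw [hcast] at this
        rw [show -i = i by linear_combination -this]
      · have := hz _ h
        push_cast at this
        rw [hcast] at this
        rw [show -i = i + 1 by linear_combination -this]
        exact (gen_braid (by omega) i).symm
      · have := congrArg (Nat.cast : ℕ → ZMod s) h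
        push_cast at this
        rw [hcast, CharP.cast_eq_zero] at this
        have hb := gen_braid (s := s) (by omega) (-i)
        rwa [show -i + 1 = i by linear_combination -this] at hb
    have := congrArg (fun w : affineSymm s => (w : Perm ℤ) m) hb
    simp only [Subgroup.coe_mul, Perm.mul_apply] at this ⊢
    rw [gen_apply_reflect, gen_apply_reflect, gen_apply_reflect, neg_neg, this]

/-! ### Sorting -/

/-- The energy which sorting decreases. -/
def energy (s : ℕ) (T : ℤ) (h : ℤ → ℤ) : ℤ := ∑ j ∈ Finset.range s, (s * h j - T * j) ^ 2

theorem energy_nonneg (s : ℕ) (T : ℤ) (h : ℤ → ℤ) : 0 ≤ energy s T h :=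
  Finset.sum_nonneg fun _ _ => sq_nonneg _

theorem sum_range_ite_zmod {s : ℕ} (hs : 2 ≤ s) (a : ZMod s) (x : ℤ) :
    ∑ m ∈ Finset.range s, (if (((m : ℕ) : ℤ) : ZMod s) = a then x else 0) = x := by
  have : NeZero s := ⟨by omega⟩
  rw [Finset.sum_eq_single a.val]
  · simp
  · intro b hb hne
    rw [if_neg]
    rintro rfl
    rw [Int.cast_natCast] at hne
    exact hne (ZMod.val_cast_of_lt (Finset.mem_range.1 hb)).symm
  · intro h
    exact absurd (Finset.mem_range.2 (ZMod.val_lt a)) h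

theorem energy_comp_gen_lt {s : ℕ} (hs : 2 ≤ s) {T : ℤ} (hT : 0 < T) {h : ℤ → ℤ}
    (hh : ∀ i, h (i + s) = h i + T) {i : ℤ} (hi : h i < h (i - 1)) :
    energy s T (h ∘ (gen hs (i : ZMod s) : Perm ℤ)) < energy s T h := by
  have h01 := one_ne_zero_of_two_le hs
  -- `s * h j - T * j` is `s`-periodic, so only the summands at the residues of `i - 1` and `i`
  -- change. The swap lowers the energy by `2 * s * T * (h (i - 1) - h i)`.
  have key : energy s T (h ∘ (gen hs (i : ZMod s) : Perm ℤ)) - energy s T h =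
      ((s * h i - T * (i - 1)) ^ 2 - (s * h (i - 1) - T * (i - 1)) ^ 2) +
      ((s * h (i - 1) - T * i) ^ 2 - (s * h i - T * i) ^ 2) := by
    unfold energy
    rw [← Finset.sum_sub_distrib,
      ← sum_range_ite_zmod hs ((i - 1 : ℤ) : ZMod s)
        ((s * h i - T * (i - 1)) ^ 2 - (s * h (i - 1) - T * (i - 1)) ^ 2),
      ← sum_range_ite_zmod hs (i : ZMod s) ((s * h (i - 1) - T * i) ^ 2 - (s * h i - T * i) ^ 2),
      ← Finset.sum_add_distrib]
    refine Finset.sum_congr rfl fun j _ => ?_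
    simp only [Function.comp]
    generalize (j : ℤ) = j
    have hcast : ∀ a : ℤ, (j : ZMod s) = (a : ZMod s) → ∃ k, j = a + s * k := by
      intro a ha
      obtain ⟨k, hk⟩ := (ZMod.intCast_eq_intCast_iff_dvd_sub _ _ _).1 ha.symm
      exact ⟨k, by linarith⟩
    have hper := fun m => (gen hs (i : ZMod s)).2.1 m
    by_cases h1 : (j : ZMod s) = ((i - 1 : ℤ) : ZMod s)
    · have h2 : ¬ (j : ZMod s) = i := by
        intro h2
        push_cast at h1
        exact h01 (by linear_combination h1 - h2)
      obtain ⟨k, rfl⟩ := hcast _ h1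
      rw [if_pos h1, if_neg h2, quasi_add_mul hper, gen_apply_sub_one, quasi_add_mul hh,
        quasi_add_mul hh]
      ring
    · by_cases h2 : (j : ZMod s) = i
      · obtain ⟨k, rfl⟩ := hcast _ h2
        rw [if_neg h1, if_pos h2, quasi_add_mul hper, gen_apply_self, quasi_add_mul hh,
          quasi_add_mul hh]
        ring
      · rw [if_neg h1, if_neg h2, gen_apply_of_not_dvd]
        · ring
        · rintro ⟨k, hk⟩
          exact h2 (by rw [show j = i + s * k by linarith]; simp)
        · rintro ⟨k, hk⟩
          exact h1 (by rw [show j = i - 1 + s * k by linarith]; simp)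
  have : 0 < s * T * (h (i - 1) - h i) := by
    have : (0 : ℤ) < s := by omega
    have : 0 < h (i - 1) - h i := by omega
    positivity
  nlinarith

/-- The symmetry of `h` turns a descent at `l` into one at `-l`, so the factors of `v_l` act as
successive strictly decreasing swaps. When `2 * l = s` two of the three factors cancel. -/
theorem energy_comp_hypGen_lt {s : ℕ} (hs : 2 ≤ s) {T C : ℤ} (hT : 0 < T) {h : ℤ → ℤ}
    (hh : IsQuasi s T C h) {l : ℕ} (hl : l ≤ s / 2) (hi : h l < h (l - 1)) :
    energy s T (h ∘ (hypGen hs (l : ZMod s) : Perm ℤ)) < energy s T h := by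
  have hper : ∀ (i : ZMod s) {g : ℤ → ℤ}, (∀ m, g (m + s) = g m + T) →
      ∀ m, (g ∘ (gen hs i : Perm ℤ)) (m + s) = (g ∘ (gen hs i : Perm ℤ)) m + T := by
    intro i g hg m
    simp only [Function.comp, (gen hs i).2.1, hg]
  have hdvd : ∀ k : ℤ, (k : ZMod s) = 0 → (s : ℤ) ∣ k := fun k hk =>
    (ZMod.intCast_zmod_eq_zero_iff_dvd _ _).1 hk
  have hlz : ((l : ℕ) : ZMod s) = ((l : ℤ) : ZMod s) := by simp
  have hstep1 := energy_comp_gen_lt hs hT hh.1 hi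
  have hrefl1 := hh.2 l
  have hrefl2 := hh.2 (l - 1)
  rw [show -1 - (l : ℤ) = -l - 1 by ring] at hrefl1
  rw [show -1 - ((l : ℤ) - 1) = -l by ring] at hrefl2
  rcases Nat.eq_zero_or_pos l with rfl | hl0
  · rw [hypGen, if_pos (by simp)]
    simpa using hstep1
  have hne0 : ((l : ℕ) : ZMod s) ≠ 0 := by
    rw [hlz]
    exact fun h => not_dvd_of_lt (by omega) (by omega) (hdvd _ h)
  rcases hl.lt_or_eq with hlu | hlu
  · rw [hypGen, if_neg hne0, if_pos ⟨l, hl0, hlu, Or.inl rfl⟩, Subgroup.coe_mul, Perm.coe_mul,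
      ← Function.comp_assoc]
    have hneg : -((l : ℕ) : ZMod s) = ((-l : ℤ) : ZMod s) := by simp
    rw [hneg, hlz]
    refine (energy_comp_gen_lt hs hT (hper _ hh.1) ?_).trans hstep1
    simp only [Function.comp]
    rw [gen_apply_of_not_dvd hs, gen_apply_of_not_dvd hs]
    · omega
    · rw [← dvd_neg]; exact not_dvd_of_lt (by omega) (by omega)
    · rw [← dvd_neg]; exact not_dvd_of_lt (by omega) (by omega)
    · rw [← dvd_neg]; exact not_dvd_of_lt (by omega) (by omega)
    · rw [← dvd_neg]; exact not_dvd_of_lt (by omega) (by omega)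
  · rw [hypGen, if_neg hne0, if_neg]
    swap
    · rintro ⟨k, hk1, hk2, hk | hk⟩
      · refine not_dvd_of_lt (s := s) (a := l - k) (by omega) (by omega) (hdvd _ ?_)
        push_cast
        rw [hk, sub_self]
      · refine not_dvd_of_lt (s := s) (a := l + k) (by omega) (by omega) (hdvd _ ?_)
        push_cast
        rw [hk, neg_add_cancel]
    rcases Nat.even_or_odd' s with ⟨u, hu | hu⟩
    · have hneg : -((l : ℕ) : ZMod s) = (l : ZMod s) := by
        have : ((2 * l : ℕ) : ZMod s) = 0 := by
          rw [show 2 * l = s by omega]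
          simp
        push_cast at this
        linear_combination -this
      rw [hneg, gen_mul_self, one_mul, hlz]
      exact hstep1
    · have hs3 : (s : ℤ) = 2 * l + 1 := by omega
      have hneg : -((l : ℕ) : ZMod s) = ((l + 1 : ℤ) : ZMod s) := by
        have : ((2 * l + 1 : ℕ) : ZMod s) = 0 := by
          rw [show 2 * l + 1 = s by omega]
          simp
        push_cast at this ⊢
        linear_combination -this
      -- For odd `s`, `h l` is the midpoint of `h (l - 1)` and `h (l + 1)`. So the three values
      -- decrease, and `v_l` reverses them by three decreasing swaps.
      have h3 : h (l + 1) = h (-l) + T := by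
        rw [← hh.1]
        congr 1
        omega
      have h4 : h l = h (-l - 1) + T := by
        rw [← hh.1]
        congr 1
        omega
      have hc1 : (gen hs ((l : ℤ) : ZMod s) : Perm ℤ) (l + 1) = l + 1 :=
        gen_apply_of_not_dvd hs (not_dvd_of_lt (by omega) (by omega))
          (not_dvd_of_lt (by omega) (by omega))
      have hc2 : (gen hs ((l + 1 : ℤ) : ZMod s) : Perm ℤ) (l - 1) = l - 1 := by
        apply gen_apply_of_not_dvd hs <;> rw [← dvd_neg]
        · exact not_dvd_of_lt (by omega) (by omega)
        · exact not_dvd_of_lt (by omega) (by omega)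
      have hc3 := gen_apply_sub_one hs (l + 1)
      rw [add_sub_cancel_right] at hc3
      rw [hneg, hlz, Subgroup.coe_mul, Subgroup.coe_mul, Perm.coe_mul, Perm.coe_mul,
        ← Function.comp_assoc, ← Function.comp_assoc]
      refine (energy_comp_gen_lt hs hT (hper _ (hper _ hh.1)) ?_).trans
        ((energy_comp_gen_lt hs hT (hper _ hh.1) ?_).trans hstep1)
      · simp only [Function.comp]
        rw [hc3, hc1, hc2, gen_apply_sub_one]
        omega
      · simp only [Function.comp]
        rw [add_sub_cancel_right, hc1, gen_apply_self]
        omega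

theorem exists_lt_sub_one_of_not_monotone {h : ℤ → ℤ} (hm : ¬ Monotone h) :
    ∃ i, h i < h (i - 1) := by
  by_contra! hc
  exact hm (monotone_int_of_le_succ fun n => by simpa using hc (n + 1))

/-- Quasi-periodicity moves a descent to some `0 ≤ r < s`, and reflection exchanges descents at `r`
and `s - r`. -/
theorem IsQuasi.exists_descent {s : ℕ} (hs : 2 ≤ s) {T C : ℤ} {h : ℤ → ℤ}
    (hh : IsQuasi s T C h) (hm : ¬ Monotone h) : ∃ l : ℕ, l ≤ s / 2 ∧ h l < h (l - 1) := by
  obtain ⟨i, hi⟩ := exists_lt_sub_one_of_not_monotone hm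
  have h1 := Int.emod_nonneg i (b := (s : ℤ)) (by omega)
  have h2 := Int.emod_lt_of_pos i (b := (s : ℤ)) (by omega)
  have h3 := Int.emod_add_mul_ediv i s
  obtain ⟨r, hr⟩ := Int.eq_ofNat_of_zero_le h1
  rw [hr] at h2 h3
  rw [← h3, quasi_add_mul hh.1, add_sub_right_comm, quasi_add_mul hh.1] at hi
  by_cases hru : r ≤ s / 2
  · exact ⟨r, hru, by omega⟩
  · refine ⟨s - r, by omega, ?_⟩
    have e1 := hh.2 r
    have e2 := hh.2 (r - 1)
    have e3 := hh.1 (-1 - r)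
    have e4 := hh.1 (-1 - (r - 1))
    rw [Nat.cast_sub (by omega)]
    rw [show -1 - (r : ℤ) + s = s - r - 1 by ring] at e3
    rw [show -1 - ((r : ℤ) - 1) + s = s - r by ring] at e4
    omega

/-! ### Existence and uniqueness of sorted representatives -/

theorem hyp_isQuasi {s : ℕ} (hs : 2 ≤ s) (w : hyp hs) : IsQuasi s s (-1) (w : Perm ℤ) := by
  refine ⟨(w : affineSymm s).2.1, ?_⟩
  obtain ⟨w, hw⟩ := w
  change ∀ i, (w : Perm ℤ) (-1 - i) = -1 - (w : Perm ℤ) i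
  induction hw using Subgroup.closure_induction with
  | mem x hx =>
    obtain ⟨i, rfl⟩ := hx
    exact hypGen_reflect hs i
  | one => exact fun _ => rfl
  | mul x y _ _ hx hy => exact fun i => by simp only [Subgroup.coe_mul, Perm.mul_apply, hx, hy]
  | inv x _ hx =>
    intro i
    apply (x : Perm ℤ).injective
    rw [hx]
    simp

/-- Every symmetric quasi-periodic function of positive slope is sorted by some element of the
affine hyperoctahedral group. -/
theorem IsQuasi.exists_monotone {s : ℕ} (hs : 2 ≤ s) {T C : ℤ} (hT : 0 < T) {h : ℤ → ℤ}
    (hh : IsQuasi s T C h) : ∃ w : hyp hs, Monotone (h ∘ (w : Perm ℤ)) := by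
  -- Energies are nonnegative integers, so some group element minimises them; a remaining descent
  -- would allow a generator to lower the energy further.
  let f : hyp hs → ℕ := fun w => (energy s T (h ∘ (w : Perm ℤ))).toNat
  refine ⟨Function.argmin f, ?_⟩
  set w := Function.argmin f with hw
  by_contra hm
  have hq := hh.comp (hyp_isQuasi hs w)
  obtain ⟨l, hl, hi⟩ := hq.exists_descent hs hm
  have hlt := energy_comp_hypGen_lt hs hT hq hl hi
  have hle : f w ≤ f (w * ⟨hypGen hs (l : ZMod s), Subgroup.subset_closure ⟨_, rfl⟩⟩) :=
    Function.argmin_le f _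
  have h0 := energy_nonneg s T
    ((h ∘ (w : Perm ℤ)) ∘ (hypGen hs (l : ZMod s) : Perm ℤ))
  simp only [f, Subgroup.coe_mul, Perm.coe_mul, ← Function.comp_assoc] at hle
  omega

/-- The affine hyperoctahedral group consists of all symmetric elements of the affine symmetric
group. -/
theorem IsQuasi.exists_hyp {s : ℕ} (hs : 2 ≤ s) {f : ℤ → ℤ} (hf : IsQuasi s s (-1) f)
    (hb : Function.Bijective f) : ∃ w : hyp hs, ((w : affineSymm s) : Perm ℤ) = f := by
  -- Sort `f` itself: the result is a monotone symmetric bijection, hence the identity, so the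
  -- sorting element is the inverse of `f`.
  obtain ⟨w, hw⟩ := hf.exists_monotone hs (by omega)
  have hq := hf.comp (hyp_isQuasi hs w)
  have hgb : Function.Bijective (f ∘ (w : Perm ℤ)) := hb.comp (Equiv.bijective _)
  generalize hg : f ∘ (w : Perm ℤ) = g at *
  have hsm : StrictMono g := hw.strictMono_of_injective hgb.1
  have hsucc : ∀ n, g (n + 1) = g n + 1 := by
    intro n
    obtain ⟨j, hj⟩ := hgb.2 (g n + 1)
    have h1 : n < j := hsm.lt_iff_lt.1 (by omega)
    have h2 := hw (show n + 1 ≤ j by omega)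
    have h3 := hsm (show n < n + 1 by omega)
    omega
  -- Unit steps leave only a translation, which symmetry at `0` and `-1` excludes.
  have h0 : g 0 = 0 := by
    have h1 := hq.2 0
    have h2 := hsucc (-1)
    norm_num at h1 h2
    omega
  have hid : ∀ n, g n = n := by
    intro n
    induction n using Int.induction_on with
    | zero => exact h0
    | succ k ih => rw [hsucc, ih]
    | pred k ih =>
      have := hsucc (-(k : ℤ) - 1)
      rw [sub_add_cancel, ih] at this
      omega
  refine ⟨w⁻¹, funext fun i => ?_⟩
  obtain ⟨j, rfl⟩ := (w : Perm ℤ).surjective i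
  have := hid j
  rw [← hg] at this
  simpa using this.symm

theorem hyp_ext {s : ℕ} {hs : 2 ≤ s} {v w : hyp hs}
    (h : ∀ i : ℤ, ((v : affineSymm s) : Perm ℤ) i = ((w : affineSymm s) : Perm ℤ) i) : v = w :=
  Subtype.ext (Subtype.ext (Equiv.ext h))

/-- Sorting is unique: an orbit contains at most one monotone function. -/
theorem IsQuasi.comp_eq_of_monotone {s : ℕ} (hs : 2 ≤ s) {T C : ℤ} {h w : ℤ → ℤ}
    (hh : IsQuasi s T C h) (hw : IsQuasi s s (-1) w) (hb : Function.Bijective w)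
    (h1 : Monotone h) (h2 : Monotone (h ∘ w)) : h ∘ w = h := by
  have key : ∀ i, h (w i) ≤ h i := by
    intro i
    by_contra! hi
    -- Translate far enough left that `[a, -1 - a]` is a nonempty interval, stable under reflection.
    obtain ⟨k, hk⟩ : ∃ k : ℕ, i - s * k ≤ -1 - (i - s * k) := by
      refine ⟨i.natAbs + 1, ?_⟩
      have : ((i.natAbs + 1 : ℕ) : ℤ) ≤ s * (i.natAbs + 1 : ℕ) :=
        le_mul_of_one_le_left (by omega) (by omega)
      omega
    set a := i - s * k with ha
    have hha : h a < h (w a) := by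
      have e1 := quasi_add_mul hh.1 a k
      have e2 := quasi_add_mul hw.1 a k
      rw [ha, sub_add_cancel, ← ha] at e1 e2
      rw [e2, quasi_add_mul hh.1] at hi
      omega
    have hup : ∀ j, a ≤ j → a < w j := by
      intro j hj
      by_contra! hc
      have e1 : h (w a) ≤ h (w j) := h2 hj
      have e2 := h1 hc
      omega
    -- For `j` in the interval, `w j` and `w (-1 - j) = -1 - w j` both exceed `a`. So `w` would
    -- inject `-2 * a` integers into `-2 * a - 2`.
    have hmaps : Set.MapsTo w (Finset.Icc a (-1 - a)) (Finset.Icc (a + 1) (-2 - a)) := by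
      intro j hj
      simp only [Finset.coe_Icc, Set.mem_Icc] at hj ⊢
      have e1 := hup j hj.1
      have e2 := hup (-1 - j) (by omega)
      rw [hw.2] at e2
      omega
    have := Finset.card_le_card_of_injOn w hmaps hb.1.injOn
    simp only [Int.card_Icc] at this
    omega
  funext i
  refine le_antisymm (key i) ?_
  have := key (-1 - i)
  rw [hw.2, hh.2, hh.2] at this
  exact (sub_le_sub_iff_left C).1 this

/-! ### Symmetric quasi-periodic functions with prescribed values -/

/-- Translations by `s` and the reflection carry any integer to some `r < s / 2`, or to the
self-reflected middle residue when `s` is odd. -/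
theorem symm_induction {s : ℕ} (hs : 2 ≤ s) {P : ℤ → Prop} (hshift : ∀ i k : ℤ, P i → P (i + s * k))
    (hrefl : ∀ i, P i → P (-1 - i)) (hlow : ∀ r : ℕ, r < s / 2 → P r)
    (hmid : ∀ r : ℕ, s = 2 * r + 1 → P r) (i : ℤ) : P i := by
  have h1 := Int.emod_nonneg i (b := (s : ℤ)) (by omega)
  have h2 := Int.emod_lt_of_pos i (b := (s : ℤ)) (by omega)
  have h3 := Int.emod_add_mul_ediv i s
  obtain ⟨r, hr⟩ := Int.eq_ofNat_of_zero_le h1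
  rw [hr] at h2 h3
  rw [← h3]
  apply hshift
  by_cases h : r < s / 2
  · exact hlow r h
  · by_cases h' : s = 2 * r + 1
    · exact hmid r h'
    · have := hshift _ 1 (hrefl _ (hlow (s - 1 - r) (by omega)))
      rwa [show -1 - ((s - 1 - r : ℕ) : ℤ) + s * 1 = r by omega] at this

theorem IsQuasi.two_mul_mid {s : ℕ} {T C : ℤ} {h : ℤ → ℤ} (hh : IsQuasi s T C h) {r : ℕ}
    (hr : s = 2 * r + 1) : 2 * h r = C + T := by
  have h1 := hh.1 (-1 - r)
  rw [hh.2, show -1 - (r : ℤ) + s = r by omega] at h1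
  omega

theorem IsQuasi.ext {s : ℕ} (hs : 2 ≤ s) {T C : ℤ} {g h : ℤ → ℤ} (hg : IsQuasi s T C g)
    (hh : IsQuasi s T C h) (he : ∀ r : ℕ, r < s / 2 → g r = h r) : g = h := by
  funext i
  refine symm_induction hs (P := fun i => g i = h i) ?_ ?_ he ?_ i
  · intro i k hi
    rw [quasi_add_mul hg.1, quasi_add_mul hh.1, hi]
  · intro i hi
    rw [hg.2, hh.2, hi]
  · intro r hr
    have := hg.two_mul_mid hr
    have := hh.two_mul_mid hr
    omega

/-- Values on `r < s / 2` are free and determine the others, except that for odd `s` the middle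
value is forced to be `(C + T) / 2`; hence the parity hypothesis. -/
theorem exists_isQuasi {s : ℕ} (hs : 2 ≤ s) (T C : ℤ) (hTC : s % 2 = 1 → (C + T) % 2 = 0)
    (f : ℕ → ℤ) : ∃ h, IsQuasi s T C h ∧ ∀ r : ℕ, r < s / 2 → h r = f r := by
  let b : ℕ → ℤ := fun r => if r < s / 2 then f r else if s = 2 * r + 1 then (C + T) / 2
    else C + T - f (s - 1 - r)
  have hb : ∀ r, r < s → b (s - 1 - r) = C + T - b r := by
    intro r hr
    simp only [b]
    by_cases h1 : r < s / 2
    · rw [if_pos h1, if_neg (by omega), if_neg (by omega), show s - 1 - (s - 1 - r) = r by omega]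
    · by_cases h2 : s = 2 * r + 1
      · have := hTC (by omega)
        rw [if_neg (by omega), if_pos (by omega), if_neg h1, if_pos h2]
        omega
      · rw [if_pos (by omega), if_neg h1, if_neg h2]
        ring
  let h : ℤ → ℤ := fun i => T * (i / s) + b (i % s).toNat
  have hval : ∀ (r : ℕ) (q : ℤ), r < s → h (r + s * q) = T * q + b r := by
    intro r q hr
    have e1 : ((r : ℤ) + s * q) / s = q := by
      rw [Int.add_mul_ediv_left _ _ (by omega), Int.ediv_eq_zero_of_lt (by omega) (by omega),
        zero_add]
    have e2 : ((r : ℤ) + s * q) % s = r := by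
      rw [Int.add_mul_emod_self_left, Int.emod_eq_of_lt (by omega) (by omega)]
    simp only [h, e1, e2, Int.toNat_natCast]
  have hdec : ∀ i : ℤ, ∃ (r : ℕ) (q : ℤ), r < s ∧ i = r + s * q := by
    intro i
    have h1 := Int.emod_nonneg i (b := (s : ℤ)) (by omega)
    have h2 := Int.emod_lt_of_pos i (b := (s : ℤ)) (by omega)
    have h3 := Int.emod_add_mul_ediv i s
    exact ⟨(i % s).toNat, i / s, by omega, by omega⟩
  refine ⟨h, ⟨fun i => ?_, fun i => ?_⟩, fun r hr => ?_⟩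
  · obtain ⟨r, q, hr, rfl⟩ := hdec i
    rw [show (r : ℤ) + s * q + s = r + s * (q + 1) by ring, hval _ _ hr, hval _ _ hr]
    ring
  · obtain ⟨r, q, hr, rfl⟩ := hdec i
    have : -1 - ((r : ℤ) + s * q) = ((s - 1 - r : ℕ) : ℤ) + s * (-1 - q) := by
      rw [show ((s - 1 - r : ℕ) : ℤ) = s - 1 - r by omega]
      ring
    rw [this, hval _ _ hr, hval _ _ (by omega), hb r hr]
    ring
  · have := hval r 0 (by omega)
    simp only [mul_zero, add_zero, zero_add] at this
    rw [this]
    simp only [b, if_pos hr]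

/-- Symmetric quasi-periodic functions in a box which is a fundamental domain for translations. -/
def box (s : ℕ) (T C : ℤ) : Set (ℤ → ℤ) :=
  {h | IsQuasi s T C h ∧ ∀ r : ℕ, r < s / 2 → 0 ≤ h r ∧ h r < T}

/-- Functions in the box correspond to arbitrary residues modulo `t`. -/
noncomputable def boxEquiv {s : ℕ} (hs : 2 ≤ s) (t : ℕ) (C : ℤ)
    (hTC : s % 2 = 1 → (C + t) % 2 = 0) : box s t C ≃ (Fin (s / 2) → Fin t) :=
  Equiv.ofBijective (fun h r => ⟨(h.1 (r : ℕ)).toNat, by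
    have := h.2.2 r r.2
    exact (Int.toNat_lt this.1).2 this.2⟩) <| by
  constructor
  · rintro ⟨g, hg, hg'⟩ ⟨h, hh, hh'⟩ he
    refine Subtype.ext (hg.ext hs hh fun r hr => ?_)
    have h1 := Fin.ext_iff.1 (congrFun he ⟨r, hr⟩)
    have := hg' r hr
    have := hh' r hr
    change (g r).toNat = (h r).toNat at h1
    change g r = h r
    omega
  · intro f
    obtain ⟨h, hh, hf⟩ := exists_isQuasi hs t C hTC
      (fun r => if hr : r < s / 2 then (f ⟨r, hr⟩ : ℕ) else 0)
    have hf' : ∀ r (hr : r < s / 2), h r = (f ⟨r, hr⟩ : ℕ) := fun r hr => by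
      rw [hf r hr, dif_pos hr]
    refine ⟨⟨h, hh, fun r hr => ?_⟩, ?_⟩
    · have := (f ⟨r, hr⟩).2
      rw [hf' r hr]
      omega
    · funext r
      apply Fin.ext
      simp only [hf' r r.2, Int.toNat_natCast]

theorem finite_box {s : ℕ} (hs : 2 ≤ s) (t : ℕ) (C : ℤ)
    (hTC : s % 2 = 1 → (C + t) % 2 = 0) : (box s t C).Finite :=
  have := Finite.of_equiv _ (boxEquiv hs t C hTC).symm
  Set.toFinite _

theorem card_box {s : ℕ} (hs : 2 ≤ s) (t : ℕ) (C : ℤ)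
    (hTC : s % 2 = 1 → (C + t) % 2 = 0) : Nat.card (box s t C) = t ^ (s / 2) := by
  rw [Nat.card_congr (boxEquiv hs t C hTC)]
  simp

/-! ### The finite hyperoctahedral group -/

/-- The reflection is an involution with at most one fixed point, so it is a product of `s / 2`
disjoint transpositions, and the cycle type gives the order of its centraliser. -/
theorem card_centralizer_reflection {s : ℕ} (hs : 2 ≤ s) :
    Nat.card (Subgroup.centralizer {(Equiv.subLeft (-1 : ZMod s) : Perm (ZMod s))}) =
      2 ^ (s / 2) * (s / 2).factorial := by
  have : NeZero s := ⟨by omega⟩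
  set ι : Perm (ZMod s) := Equiv.subLeft (-1 : ZMod s) with hι
  have hsq : ι ^ 2 = 1 := by
    ext x
    simp [hι, pow_two]
  have hct := Equiv.Perm.cycleType_of_pow_prime_eq_one (p := 2) hsq
  set n := Multiset.card ι.cycleType with hn
  have hfix : (ι.supportᶜ).card ≤ 1 := by
    rw [Finset.card_le_one]
    have hval : ∀ x : ZMod s, x ∈ ι.supportᶜ → 2 * x.val + 1 = s := by
      intro x hx
      have hx' : -1 - x = x := by simpa [hι] using hx
      have h1 : ((2 * x.val + 1 : ℕ) : ZMod s) = 0 := by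
        push_cast
        rw [ZMod.natCast_zmod_val]
        linear_combination -hx'
      obtain ⟨k, hk⟩ := (ZMod.natCast_eq_zero_iff _ _).1 h1
      have h2 := ZMod.val_lt x
      have h3 : 0 < k := by
        rcases Nat.eq_zero_or_pos k with rfl | h
        · omega
        · exact h
      have h4 : k < 2 := by
        by_contra h4
        have := Nat.mul_le_mul_left s (not_lt.1 h4)
        omega
      obtain rfl : k = 1 := by omega
      omega
    intro x hx y hy
    have := hval x hx
    have := hval y hy
    exact ZMod.val_injective s (by omega)
  have hsum : ι.cycleType.sum = 2 * n := by
    rw [hct]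
    simp [mul_comm]
  have h1 := ι.sum_cycleType
  have h2 := Finset.card_compl_add_card ι.support
  rw [ZMod.card] at h2
  have hn2 : n = s / 2 := by omega
  have hn0 : n ≠ 0 := by omega
  rw [Perm.nat_card_centralizer, hsum, ZMod.card, hct, ← hn2, Multiset.prod_replicate,
    Multiset.toFinset_replicate, if_neg hn0, Finset.prod_singleton, Multiset.count_replicate_self]
  have : s - 2 * n = 0 ∨ s - 2 * n = 1 := by omega
  rcases this with h | h <;> rw [h] <;> simp

/-! ### Reduction modulo `s` and lifting into the box -/

theorem quasi_cast_apply {s : ℕ} {g : ℤ → ℤ} (hg : ∀ i, g (i + s) = g i + s) (i : ℤ) :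
    ((g ((i : ZMod s).cast : ℤ) : ℤ) : ZMod s) = (g i : ZMod s) := by
  have h := Int.emod_add_mul_ediv i s
  rw [ZMod.coe_intCast]
  conv_rhs => rw [← h, quasi_add_mul hg]
  simp

/-- The permutation of residues induced by an element of the affine hyperoctahedral group. -/
def residuePerm {s : ℕ} {hs : 2 ≤ s} (w : hyp hs) : Perm (ZMod s) where
  toFun x := ((w : Perm ℤ) (x.cast : ℤ) : ℤ)
  invFun x := (((w⁻¹ : hyp hs) : Perm ℤ) (x.cast : ℤ) : ℤ)
  left_inv x := by
    refine (quasi_cast_apply (hyp_isQuasi hs w⁻¹).1 _).trans ?_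
    simp
  right_inv x := by
    refine (quasi_cast_apply (hyp_isQuasi hs w).1 _).trans ?_
    simp

theorem residuePerm_intCast {s : ℕ} {hs : 2 ≤ s} (w : hyp hs) (i : ℤ) :
    residuePerm w (i : ZMod s) = ((w : Perm ℤ) i : ZMod s) :=
  quasi_cast_apply (hyp_isQuasi hs w).1 i

theorem residuePerm_mem {s : ℕ} {hs : 2 ≤ s} (w : hyp hs) :
    residuePerm w ∈ Subgroup.centralizer {(Equiv.subLeft (-1 : ZMod s) : Perm (ZMod s))} := by
  rw [Subgroup.mem_centralizer_singleton_iff]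
  ext x
  obtain ⟨i, rfl⟩ := ZMod.intCast_surjective x
  simp only [Perm.mul_apply, Equiv.subLeft_apply]
  rw [show (-1 : ZMod s) - i = ((-1 - i : ℤ) : ZMod s) by push_cast; ring, residuePerm_intCast,
    residuePerm_intCast, (hyp_isQuasi hs w).2]
  push_cast
  ring

/-- The elements of the affine hyperoctahedral group which move `m` into the box. -/
def boxMovers {s : ℕ} (hs : 2 ≤ s) (T C : ℤ) (m : ℤ → ℤ) : Set (hyp hs) :=
  {w | m ∘ (w : Perm ℤ) ∈ box s T C}

/-- The lift of a symmetric permutation of residues. -/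
theorem exists_hyp_lift {s : ℕ} (hs : 2 ≤ s) {T C : ℤ} (hT : 0 < T) {m : ℤ → ℤ}
    (hm : IsQuasi s T C m) {σ : Perm (ZMod s)}
    (hσ : σ ∈ Subgroup.centralizer {(Equiv.subLeft (-1 : ZMod s) : Perm (ZMod s))}) :
    ∃ w : hyp hs, w ∈ boxMovers hs T C m ∧ residuePerm w = σ := by
  have hσ' : ∀ x, σ (-1 - x) = -1 - σ x := fun x => by
    have := congrArg (fun τ : Perm (ZMod s) => τ x) (Subgroup.mem_centralizer_singleton_iff.1 hσ)
    simpa using this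
  let a : ℕ → ℤ := fun r => (σ (r : ZMod s)).cast
  -- The multiple of `s` added to the representative `a r` replaces `m (a r)` by its remainder
  -- modulo `T`, as the box requires.
  obtain ⟨g, hg, hgf⟩ := exists_isQuasi hs s (-1) (by omega) fun r => a r + s * -(m (a r) / T)
  have hmod : ∀ i : ℤ, (g i : ZMod s) = σ (i : ZMod s) := by
    refine symm_induction hs ?_ ?_ ?_ ?_
    · intro i k hi
      rw [quasi_add_mul hg.1]
      simpa using hi
    · intro i hi
      rw [hg.2]
      push_cast
      rw [hi, hσ']
    · intro r hr
      rw [hgf r hr]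
      simp [a]
    · intro r hr
      have h1 := hg.two_mul_mid hr
      have h2 : g r = r := by omega
      have h3 : ((2 * r + 1 : ℕ) : ZMod s) = 0 := by
        rw [← hr]
        simp
      have h4 := hσ' (r : ZMod s)
      push_cast at h3
      rw [show -1 - (r : ZMod s) = r by linear_combination -h3] at h4
      rw [h2]
      push_cast
      -- Both `r` and `σ r` solve `2 * x + 1 = 0`, and `r + 1` is the inverse of `2` modulo `s`.
      linear_combination (r + 1) * h3 - (r + 1) * h4 - (r - σ (r : ZMod s)) * h3
  have hlift : ∀ i j : ℤ, (g i : ZMod s) = (j : ZMod s) → ∃ k, g (i + s * k) = j := by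
    intro i j h
    obtain ⟨k, hk⟩ := (ZMod.intCast_eq_intCast_iff_dvd_sub _ _ _).1 h
    exact ⟨k, by rw [quasi_add_mul hg.1]; linarith⟩
  have hbij : Function.Bijective g := by
    constructor
    · intro i j hij
      have h1 : (i : ZMod s) = (j : ZMod s) := σ.injective (by rw [← hmod, ← hmod, hij])
      obtain ⟨k, hk⟩ := (ZMod.intCast_eq_intCast_iff_dvd_sub _ _ _).1 h1
      obtain rfl : j = i + s * k := by linarith
      rw [quasi_add_mul hg.1] at hij
      omega
    · intro j
      obtain ⟨i, hi⟩ := ZMod.intCast_surjective (σ⁻¹ (j : ZMod s))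
      obtain ⟨k, hk⟩ := hlift i j (by rw [hmod, hi]; simp)
      exact ⟨_, hk⟩
  obtain ⟨w, rfl⟩ := hg.exists_hyp hs hbij
  refine ⟨w, ⟨hm.comp hg, fun r hr => ?_⟩, ?_⟩
  · have h1 := Int.emod_nonneg (m (a r)) hT.ne'
    have h2 := Int.emod_lt_of_pos (m (a r)) hT
    have h3 := Int.emod_add_mul_ediv (m (a r)) T
    simp only [Function.comp]
    rw [hgf r hr, quasi_add_mul hm.1, mul_neg]
    omega
  · ext x
    obtain ⟨i, rfl⟩ := ZMod.intCast_surjective x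
    rw [residuePerm_intCast, hmod]

theorem card_boxMovers {s : ℕ} (hs : 2 ≤ s) {T C : ℤ} (hT : 0 < T) {m : ℤ → ℤ}
    (hm : IsQuasi s T C m) :
    Nat.card (boxMovers hs T C m) = 2 ^ (s / 2) * (s / 2).factorial := by
  rw [← card_centralizer_reflection hs]
  refine Nat.card_eq_of_bijective (fun w => ⟨residuePerm w.1, residuePerm_mem w.1⟩) ⟨?_, ?_⟩
  · rintro ⟨v, hv⟩ ⟨w, hw⟩ he
    have he' : residuePerm v = residuePerm w := congrArg Subtype.val he
    have hq := hyp_isQuasi hs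
    refine Subtype.ext (hyp_ext fun i => congrFun ((hq v).ext hs (hq w) fun r hr => ?_) i)
    have h1 := congrArg (fun τ : Perm (ZMod s) => τ ((r : ℤ) : ZMod s)) he'
    simp only [residuePerm_intCast] at h1
    obtain ⟨k, hk⟩ := (ZMod.intCast_eq_intCast_iff_dvd_sub _ _ _).1 h1
    have h2 : (w : Perm ℤ) r = (v : Perm ℤ) r + s * k := by linarith
    have h3 := hv.2 r hr
    have h4 := hw.2 r hr
    simp only [Function.comp] at h3 h4
    rw [h2, quasi_add_mul hm.1] at h4
    -- Translation by `s * k` changes the value of `m` by `T * k`, while both values lie in `[0,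
    -- T)`.
    have h5 : k = 0 := by
      rcases lt_trichotomy k 0 with h | h | h
      · nlinarith
      · exact h
      · nlinarith
    rw [h2, h5]
    ring
  · rintro ⟨σ, hσ⟩
    obtain ⟨w, hw, rfl⟩ := exists_hyp_lift hs hT hm hσ
    exact ⟨⟨w, hw⟩, rfl⟩

/-! ### Counting orbits -/

/-- The stabiliser of a function under precomposition. -/
def stabFun {s : ℕ} (hs : 2 ≤ s) (m : ℤ → ℤ) : Set (hyp hs) := {w | m ∘ (w : Perm ℤ) = m}

/-- The part of the box in the orbit of `m`. -/
def boxOrbit {s : ℕ} (hs : 2 ≤ s) (T C : ℤ) (m : ℤ → ℤ) : Set (ℤ → ℤ) :=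
  {d | d ∈ box s T C ∧ ∃ w : hyp hs, m ∘ (w : Perm ℤ) = d}

theorem finite_boxMovers {s : ℕ} (hs : 2 ≤ s) {T C : ℤ} (hT : 0 < T) {m : ℤ → ℤ}
    (hm : IsQuasi s T C m) : Finite (boxMovers hs T C m) :=
  Nat.finite_of_card_ne_zero (by rw [card_boxMovers hs hT hm]; positivity)

theorem nonempty_boxOrbit {s : ℕ} (hs : 2 ≤ s) {T C : ℤ} (hT : 0 < T) {m : ℤ → ℤ}
    (hm : IsQuasi s T C m) : (boxOrbit hs T C m).Nonempty := by
  obtain ⟨w, hw, -⟩ := exists_hyp_lift hs hT hm (one_mem _)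
  exact ⟨_, hw, w, rfl⟩

/-- Orbit-stabiliser for the elements moving `m` into the box. -/
theorem exists_boxMoversEquiv {s : ℕ} (hs : 2 ≤ s) (T C : ℤ) (m : ℤ → ℤ) :
    Nonempty (stabFun hs m × boxOrbit hs T C m ≃ boxMovers hs T C m) := by
  have hex : ∀ d : boxOrbit hs T C m, ∃ w : hyp hs, m ∘ (w : Perm ℤ) = (d : ℤ → ℤ) :=
    fun d => d.2.2
  -- With one transporter `w d` fixed for each `d`, a mover `g` corresponds to its endpoint `d` and
  -- the stabilising element `g * (w d)⁻¹`.
  choose w hw using hex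
  have hmul : ∀ (v : stabFun hs m) (d : boxOrbit hs T C m),
      m ∘ ((v.1 * w d : hyp hs) : Perm ℤ) = d := by
    intro v d
    have hv : m ∘ ((v : hyp hs) : Perm ℤ) = m := v.2
    rw [Subgroup.coe_mul, Subgroup.coe_mul, Perm.coe_mul, ← Function.comp_assoc, hv, hw]
  have hmem : ∀ p : stabFun hs m × boxOrbit hs T C m, p.1.1 * w p.2 ∈ boxMovers hs T C m := by
    intro p
    change m ∘ ((p.1.1 * w p.2 : hyp hs) : Perm ℤ) ∈ box s T C
    rw [hmul]
    exact p.2.2.1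
  refine ⟨Equiv.ofBijective (fun p => ⟨_, hmem p⟩) ⟨?_, ?_⟩⟩
  · rintro ⟨v, d⟩ ⟨v', d'⟩ he
    have he' : v.1 * w d = v'.1 * w d' := congrArg Subtype.val he
    obtain rfl : d = d' := Subtype.ext (by rw [← hmul v d, he', hmul])
    rw [Prod.mk.injEq]
    exact ⟨Subtype.ext (mul_right_cancel he'), rfl⟩
  · rintro ⟨g, hg⟩
    let d : boxOrbit hs T C m := ⟨_, hg, g, rfl⟩
    have hd : m ∘ (w d : Perm ℤ) = m ∘ (g : Perm ℤ) := hw d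
    refine ⟨⟨⟨g * (w d)⁻¹, ?_⟩, d⟩, Subtype.ext (by simp)⟩
    change m ∘ ((g * (w d)⁻¹ : hyp hs) : Perm ℤ) = m
    rw [Subgroup.coe_mul, Subgroup.coe_mul, Perm.coe_mul, ← Function.comp_assoc, ← hd,
      Function.comp_assoc, ← Perm.coe_mul, ← Subgroup.coe_mul, ← Subgroup.coe_mul,
      mul_inv_cancel]
    rfl

theorem finite_stabFun {s : ℕ} (hs : 2 ≤ s) {T C : ℤ} (hT : 0 < T) {m : ℤ → ℤ}
    (hm : IsQuasi s T C m) : Finite (stabFun hs m) := by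
  obtain ⟨e⟩ := exists_boxMoversEquiv hs T C m
  have := finite_boxMovers hs hT hm
  have := (nonempty_boxOrbit hs hT hm).to_subtype
  have := Finite.of_equiv _ e.symm
  exact Finite.prod_left (boxOrbit hs T C m)

theorem inv_card_stabFun {s : ℕ} (hs : 2 ≤ s) {T C : ℤ} (hT : 0 < T) {m : ℤ → ℤ}
    (hm : IsQuasi s T C m) : (1 : ℚ) / Nat.card (stabFun hs m) =
      Nat.card (boxOrbit hs T C m) / (2 ^ (s / 2) * (s / 2).factorial) := by
  obtain ⟨e⟩ := exists_boxMoversEquiv hs T C m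
  have h := Nat.card_congr e
  rw [Nat.card_prod, card_boxMovers hs hT hm] at h
  have hpos : 0 < 2 ^ (s / 2) * (s / 2).factorial := by positivity
  have h0 : Nat.card (stabFun hs m) ≠ 0 := by
    intro h0
    rw [h0] at h
    omega
  have hq : (Nat.card (stabFun hs m) : ℚ) * Nat.card (boxOrbit hs T C m) =
      2 ^ (s / 2) * (s / 2).factorial := by exact_mod_cast h
  rw [div_eq_div_iff (by exact_mod_cast h0) (by positivity), one_mul, ← hq]
  ring

/-- Sorted symmetric quasi-periodic functions. -/
def sorted (s : ℕ) (T C : ℤ) : Set (ℤ → ℤ) := {m | IsQuasi s T C m ∧ Monotone m}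

theorem exists_sorted {s : ℕ} (hs : 2 ≤ s) {T C : ℤ} (hT : 0 < T) {d : ℤ → ℤ}
    (hd : d ∈ box s T C) : ∃ m ∈ sorted s T C, d ∈ boxOrbit hs T C m := by
  obtain ⟨w, hw⟩ := hd.1.exists_monotone hs hT
  refine ⟨_, ⟨hd.1.comp (hyp_isQuasi hs w), hw⟩, hd, w⁻¹, ?_⟩
  funext i
  simp

theorem sorted_unique {s : ℕ} (hs : 2 ≤ s) {T C : ℤ} {m m' d : ℤ → ℤ} (hm : m ∈ sorted s T C)
    (hm' : m' ∈ sorted s T C) (hd : d ∈ boxOrbit hs T C m) (hd' : d ∈ boxOrbit hs T C m') :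
    m = m' := by
  obtain ⟨-, w, rfl⟩ := hd
  obtain ⟨-, v, hv⟩ := hd'
  have h : m' ∘ ((v * w⁻¹ : hyp hs) : Perm ℤ) = m := by
    rw [Subgroup.coe_mul, Subgroup.coe_mul, Perm.coe_mul, ← Function.comp_assoc, hv]
    funext i
    simp
  have := hm'.1.comp_eq_of_monotone hs (hyp_isQuasi hs (v * w⁻¹)) (Equiv.bijective _) hm'.2
    (by rw [h]; exact hm.2)
  rw [← h, this]

/-- The sorted function in the orbit of a function in the box. -/
noncomputable def sortBox {s : ℕ} (hs : 2 ≤ s) {T C : ℤ} (hT : 0 < T) (d : box s T C) :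
    sorted s T C :=
  ⟨(exists_sorted hs hT d.2).choose, (exists_sorted hs hT d.2).choose_spec.1⟩

theorem sortBox_eq_iff {s : ℕ} (hs : 2 ≤ s) {T C : ℤ} (hT : 0 < T) (d : box s T C)
    (m : sorted s T C) : sortBox hs hT d = m ↔ (d : ℤ → ℤ) ∈ boxOrbit hs T C m := by
  have h := (exists_sorted hs hT d.2).choose_spec
  constructor
  · rintro rfl
    exact h.2
  · exact fun h' => Subtype.ext (sorted_unique hs h.1 m.2 h.2 h')

theorem finite_sorted {s : ℕ} (hs : 2 ≤ s) {t : ℕ} {C : ℤ} (ht : 0 < t)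
    (hTC : s % 2 = 1 → (C + t) % 2 = 0) : (sorted s t C).Finite := by
  have := (finite_box hs t C hTC).to_subtype
  have ht' : (0 : ℤ) < t := by omega
  refine @Set.toFinite _ _ (Finite.of_surjective (sortBox (C := C) hs ht') fun m => ?_)
  obtain ⟨d, hd⟩ := nonempty_boxOrbit hs ht' m.2.1
  exact ⟨⟨d, hd.1⟩, (sortBox_eq_iff hs ht' _ m).2 hd⟩

/-- The fibres of `sortBox` are the sets `boxOrbit`, so their cardinalities add up to `t ^ (s / 2)`;
`inv_card_stabFun` makes each reciprocal proportional to its fibre. -/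
theorem sum_inv_card_stabFun {s : ℕ} (hs : 2 ≤ s) {t : ℕ} {C : ℤ} (ht : 0 < t)
    (hTC : s % 2 = 1 → (C + t) % 2 = 0) :
    ∑ᶠ m ∈ sorted s t C, (1 : ℚ) / Nat.card (stabFun hs m) =
      (t : ℚ) ^ (s / 2) / (2 ^ (s / 2) * (s / 2).factorial) := by
  classical
  have ht' : (0 : ℤ) < t := by omega
  have := (finite_box hs t C hTC).to_subtype
  have := (finite_sorted hs ht hTC).to_subtype
  have := Fintype.ofFinite (sorted s t C)
  have hcard : Nat.card (box s t C) = ∑ m : sorted s t C, Nat.card (boxOrbit hs t C m) := by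
    rw [Nat.card_congr (Equiv.sigmaFiberEquiv (sortBox hs ht')).symm, Nat.card_sigma]
    refine Finset.sum_congr rfl fun m _ => Nat.card_congr ?_
    exact
      { toFun := fun d => ⟨d.1, (sortBox_eq_iff hs ht' _ m).1 d.2⟩
        invFun := fun d => ⟨⟨d.1, d.2.1⟩, (sortBox_eq_iff hs ht' _ m).2 d.2⟩
        left_inv := fun _ => rfl
        right_inv := fun _ => rfl }
  rw [card_box hs t C hTC] at hcard
  rw [← finsum_set_coe_eq_finsum_mem, finsum_eq_sum_of_fintype,
    Finset.sum_congr rfl fun m _ => inv_card_stabFun hs ht' m.2.1, ← Finset.sum_div,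
    ← Nat.cast_sum, ← hcard, Nat.cast_pow]

/-! ### Self-conjugate cores as symmetric quasi-periodic functions -/

/-- The set of integers encoded by a quasi-periodic function. -/
def abacus (s t : ℕ) (h : ℤ → ℤ) : Set ℤ := {m | ∃ i k, h i ≤ k ∧ m = t * i - shift s t - s * k}

theorem two_mul_shift {s t : ℕ} (hst : s.Coprime t) :
    2 * shift s t = ((s : ℤ) - 1) * ((t : ℤ) - 1) := by
  apply Int.mul_ediv_cancel'
  rcases Nat.even_or_odd s with hs | hs
  · rcases Nat.even_or_odd t with ht | ht
    · exact absurd (Nat.dvd_gcd hs.two_dvd ht.two_dvd) (by rw [hst.gcd_eq_one]; decide)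
    · obtain ⟨k, rfl⟩ := ht
      exact Dvd.dvd.mul_left (Dvd.intro (k : ℤ) (by push_cast; ring)) _
  · obtain ⟨k, rfl⟩ := hs
    exact Dvd.dvd.mul_right (Dvd.intro (k : ℤ) (by push_cast; ring)) _

theorem exists_abacus_coord {s t : ℕ} (hst : s.Coprime t) (m : ℤ) :
    ∃ i k : ℤ, m = t * i - shift s t - s * k := by
  obtain ⟨k, hk⟩ := gcdB_spec hst (m + shift s t)
  exact ⟨(m + shift s t) * Nat.gcdB s t, k, by linear_combination -hk⟩

/-- The value of `shift s t` is what makes the conjugation symmetry act on the first coordinate as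
`i ↦ -1 - i`. -/
theorem neg_one_sub_coord {s t : ℕ} (hst : s.Coprime t) (i k : ℤ) :
    -1 - ((t : ℤ) * i - shift s t - s * k) = t * (-1 - i) - shift s t - s * (1 - t - k) := by
  linear_combination two_mul_shift hst

/-- Another pair of coordinates differs by a multiple of `(s, t)`, and quasi-periodicity makes `h i
≤ k` invariant under this change. -/
theorem mem_abacus {s t : ℕ} (hs : 2 ≤ s) (hst : s.Coprime t) {h : ℤ → ℤ}
    (hh : ∀ i, h (i + s) = h i + t) (i k : ℤ) :
    t * i - shift s t - s * k ∈ abacus s t h ↔ h i ≤ k := by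
  refine ⟨?_, fun hk => ⟨i, k, hk, rfl⟩⟩
  rintro ⟨i', k', hk, he⟩
  have h1 : (s : ℤ) ∣ (i - i') * t := ⟨k - k', by linear_combination he⟩
  obtain ⟨q, hq⟩ := (Int.isCoprime_iff_gcd_eq_one.2 (by simpa using hst)).dvd_of_dvd_mul_right h1
  obtain rfl : i = i' + s * q := by linarith
  have h2 : k = k' + t * q := by
    have h0 : (s : ℤ) ≠ 0 := by omega
    apply mul_left_cancel₀ h0
    linear_combination -he
  rw [quasi_add_mul hh, h2]
  omega

theorem abacus_injective {s t : ℕ} (hs : 2 ≤ s) (hst : s.Coprime t) {g h : ℤ → ℤ}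
    (hg : ∀ i, g (i + s) = g i + t) (hh : ∀ i, h (i + s) = h i + t)
    (he : abacus s t g = abacus s t h) : g = h :=
  funext fun i => eq_of_forall_ge_iff fun k => by
    rw [← mem_abacus hs hst hg, he, mem_abacus hs hst hh]

/-- The reflection sends `k` to `1 - t - k`; negating an inequality of integers adds one, whence the
constant `2 - t`. -/
theorem abacus_symm {s t : ℕ} (hs : 2 ≤ s) (hst : s.Coprime t) {h : ℤ → ℤ}
    (hh : IsQuasi s t (2 - t) h) (m : ℤ) : m ∈ abacus s t h ↔ -1 - m ∉ abacus s t h := by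
  obtain ⟨i, k, rfl⟩ := exists_abacus_coord hst m
  rw [neg_one_sub_coord hst, mem_abacus hs hst hh.1, mem_abacus hs hst hh.1, hh.2]
  omega

theorem abacus_sub_left {s t : ℕ} {h : ℤ → ℤ} {m : ℤ} (hm : m ∈ abacus s t h) :
    m - s ∈ abacus s t h := by
  obtain ⟨i, k, hk, rfl⟩ := hm
  exact ⟨i, k + 1, by omega, by ring⟩

/-- Subtracting `t` lowers `i` by one and keeps `k`, so closure compares consecutive thresholds. -/
theorem abacus_sub_right_iff {s t : ℕ} (hs : 2 ≤ s) (hst : s.Coprime t) {h : ℤ → ℤ}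
    (hh : ∀ i, h (i + s) = h i + t) :
    (∀ m ∈ abacus s t h, m - t ∈ abacus s t h) ↔ Monotone h := by
  constructor
  · intro hm
    refine monotone_int_of_le_succ fun n => ?_
    have := hm _ ((mem_abacus hs hst hh (n + 1) (h (n + 1))).2 le_rfl)
    rwa [show (t : ℤ) * (n + 1) - shift s t - s * h (n + 1) - t =
      t * n - shift s t - s * h (n + 1) by ring, mem_abacus hs hst hh] at this
  · rintro hm _ ⟨i, k, hk, rfl⟩
    exact ⟨i - 1, k, (hm (by omega)).trans hk, by ring⟩

theorem isBeta_abacus {s t : ℕ} (hs : 2 ≤ s) (hst : s.Coprime t) {h : ℤ → ℤ}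
    (hh : IsQuasi s t (2 - t) h) : IsBeta (abacus s t h) := by
  -- `H` bounds every threshold on a full set of residues, so integers below the stated bound lie
  -- past all thresholds.
  let H : ℕ := ∑ r ∈ Finset.range s, (h r).natAbs
  refine isBeta_of_symm ((shift s t).natAbs + s * H) ?_ (abacus_symm hs hst hh)
  intro m hm
  obtain ⟨i, k, rfl⟩ := exists_abacus_coord hst m
  have h1 := Int.emod_nonneg i (b := (s : ℤ)) (by omega)
  have h2 := Int.emod_lt_of_pos i (b := (s : ℤ)) (by omega)
  obtain ⟨r, hr⟩ := Int.eq_ofNat_of_zero_le h1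
  have h3 := Int.emod_add_mul_ediv i s
  rw [hr] at h2 h3
  generalize i / (s : ℤ) = q at h3
  subst h3
  rw [mem_abacus hs hst hh.1, quasi_add_mul hh.1]
  have h4 : (h r).natAbs ≤ H := Finset.single_le_sum (f := fun r : ℕ => (h r).natAbs)
    (fun _ _ => Nat.zero_le _) (Finset.mem_range.2 (by omega))
  have h5 : (s : ℤ) * H < s * (k - t * q) := by
    push_cast at hm
    have h6 : (0 : ℤ) ≤ t * r := by positivity
    have h7 := le_abs_self (shift s t)
    linarith
  have h8 : (H : ℤ) < k - t * q := lt_of_mul_lt_mul_left h5 (by omega)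
  omega

theorem exists_abacus_eq_betaSet {s t : ℕ} (hs : 2 ≤ s) (hst : s.Coprime t) {μ : YoungDiagram}
    (hc : IsCore s μ) (hμ : IsSelfConj μ) :
    ∃ h, IsQuasi s t (2 - t) h ∧ abacus s t h = betaSet μ := by
  rw [isCore_iff (by omega)] at hc
  rw [isSelfConj_iff] at hμ
  obtain ⟨N, hlo, hhi, -⟩ := isBeta_betaSet μ
  have hs0 : (0 : ℤ) < s := by omega
  have hup : ∀ (i k : ℤ) (n : ℕ), (t : ℤ) * i - shift s t - s * k ∈ betaSet μ →
      (t : ℤ) * i - shift s t - s * (k + n) ∈ betaSet μ := by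
    intro i k n hk
    induction n with
    | zero => simpa using hk
    | succ n ih =>
      have := hc _ ih
      push_cast
      rwa [show (t : ℤ) * i - shift s t - s * (k + (n + 1)) =
        t * i - shift s t - s * (k + n) - s by ring]
  -- For fixed `i` the admissible `k` form an up-set by the `s`-core condition. It is bounded below
  -- because the beta-set is bounded above, and nonempty because all sufficiently negative integers
  -- are beta-numbers.
  have hex : ∀ i : ℤ, ∃ a : ℤ, ∀ k : ℤ,
      a ≤ k ↔ (t : ℤ) * i - shift s t - s * k ∈ betaSet μ := by
    intro i
    obtain ⟨a, ha, hmin⟩ := Int.exists_least_of_bdd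
      (P := fun k : ℤ => (t : ℤ) * i - shift s t - s * k ∈ betaSet μ)
      ⟨-(|(t : ℤ) * i - shift s t| + N), fun k hk => by
        by_contra! hlt
        refine hhi _ ?_ hk
        have h1 := neg_abs_le ((t : ℤ) * i - shift s t)
        have h2 : -k ≤ s * -k := by
          have := abs_nonneg ((t : ℤ) * i - shift s t)
          exact le_mul_of_one_le_left (by omega) (by omega)
        linarith⟩
      ⟨|(t : ℤ) * i - shift s t| + N + 1, hlo _ (by
        have h1 := le_abs_self ((t : ℤ) * i - shift s t)
        have h2 : |(t : ℤ) * i - shift s t| + N + 1 ≤ s * (|(t : ℤ) * i - shift s t| + N + 1) :=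
          le_mul_of_one_le_left (by positivity) (by omega)
        linarith)⟩
    refine ⟨a, fun k => ⟨fun hk => ?_, hmin k⟩⟩
    have := hup i a (k - a).toNat ha
    rwa [Int.toNat_of_nonneg (by omega), add_sub_cancel] at this
  choose h hh using hex
  refine ⟨h, ⟨fun i => ?_, fun i => ?_⟩, ?_⟩
  · refine eq_of_forall_ge_iff fun k => ?_
    rw [hh, show (t : ℤ) * (i + s) - shift s t - s * k = t * i - shift s t - s * (k - t) by ring,
      ← hh]
    omega
  · refine eq_of_forall_ge_iff fun k => ?_
    rw [hh, hμ, neg_one_sub_coord hst, sub_sub_cancel, ← hh]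
    omega
  · ext m
    constructor
    · rintro ⟨i, k, hk, rfl⟩
      exact (hh i k).1 hk
    · intro hm
      obtain ⟨i, k, rfl⟩ := exists_abacus_coord hst m
      exact ⟨i, k, (hh i k).2 hm, rfl⟩

/-! ### The level `t` action on abaci -/

/-- The coordinate `i` is a valid index in `levelFun_eq`, so adding `t * (w i - i)` replaces `i` by
`w i` and leaves `k` alone. -/
theorem levelHom_coord {s t : ℕ} (hst : s.Coprime t) (w : affineSymm s) (i k : ℤ) :
    levelHom hst w (t * i - shift s t - s * k) = t * (w : Perm ℤ) i - shift s t - s * k := by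
  change levelFun s t (w : Perm ℤ) _ = _
  rw [levelFun_eq hst w.2.1 (i := i) ⟨k, by ring⟩]
  ring

theorem levelHom_image_abacus {s t : ℕ} (hst : s.Coprime t) (w : affineSymm s) (h : ℤ → ℤ) :
    levelHom hst w '' abacus s t (h ∘ (w : Perm ℤ)) = abacus s t h := by
  ext m
  constructor
  · rintro ⟨_, ⟨i, k, hk, rfl⟩, rfl⟩
    exact ⟨(w : Perm ℤ) i, k, hk, levelHom_coord hst w i k⟩
  · rintro ⟨i, k, hk, rfl⟩
    obtain ⟨j, rfl⟩ := (w : Perm ℤ).surjective i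
    exact ⟨_, ⟨j, k, hk, rfl⟩, levelHom_coord hst w j k⟩

theorem mem_stabSC_iff {s t : ℕ} (hs : 2 ≤ s) (hst : s.Coprime t) {h : ℤ → ℤ}
    (hh : IsQuasi s t (2 - t) h) {μ : YoungDiagram} (hμ : betaSet μ = abacus s t h)
    (w : hyp hs) : w ∈ stabSC hs hst μ ↔ w ∈ stabFun hs h := by
  change levelAct hs hst w μ = μ ↔ h ∘ (w : Perm ℤ) = h
  have hq := hh.comp (hyp_isQuasi hs w)
  rw [← betaSet_injective.eq_iff, betaSet_levelAct, hμ]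
  constructor
  · intro he
    have h1 := (Equiv.injective (levelHom hst w)).image_injective
      (he.trans (levelHom_image_abacus hst w h).symm)
    exact (abacus_injective hs hst hh.1 hq.1 h1).symm
  · intro he
    conv_lhs => rw [← he]
    exact levelHom_image_abacus hst w h

/-- The partition encoded by a quasi-periodic function. -/
noncomputable def abacusDiagram (s t : ℕ) (h : ℤ → ℤ) : YoungDiagram :=
  -- When the abacus is not a beta-set this is a default diagram; for symmetric quasi-periodic `h`
  -- it is a genuine preimage.
  Function.invFun betaSet (abacus s t h)

theorem betaSet_abacusDiagram {s t : ℕ} (hs : 2 ≤ s) (hst : s.Coprime t) {h : ℤ → ℤ}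
    (hh : IsQuasi s t (2 - t) h) : betaSet (abacusDiagram s t h) = abacus s t h :=
  Function.invFun_eq (exists_betaSet (isBeta_abacus hs hst hh))

theorem bijOn_abacusDiagram {s t : ℕ} (hs : 2 ≤ s) (ht : 0 < t) (hst : s.Coprime t) :
    Set.BijOn (abacusDiagram s t) (sorted s t (2 - t)) (scCores s t) := by
  refine ⟨?_, ?_, ?_⟩
  · rintro h ⟨hh, hm⟩
    refine ⟨(isCore_iff (by omega) _).2 ?_, (isCore_iff ht _).2 ?_, (isSelfConj_iff _).2 ?_⟩ <;>
      rw [betaSet_abacusDiagram hs hst hh]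
    · exact fun m => abacus_sub_left
    · exact (abacus_sub_right_iff hs hst hh.1).2 hm
    · exact abacus_symm hs hst hh
  · rintro g ⟨hg, -⟩ h ⟨hh, -⟩ he
    apply abacus_injective hs hst hg.1 hh.1
    rw [← betaSet_abacusDiagram hs hst hg, he, betaSet_abacusDiagram hs hst hh]
  · rintro μ ⟨h1, h2, h3⟩
    obtain ⟨h, hh, he⟩ := exists_abacus_eq_betaSet hs hst h1 h3
    refine ⟨h, ⟨hh, ?_⟩, betaSet_injective ?_⟩
    · rwa [← abacus_sub_right_iff hs hst hh.1, he, ← isCore_iff ht]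
    · rw [betaSet_abacusDiagram hs hst hh, he]

/-- The stabiliser of a self-conjugate core is that of the function encoding it. -/
def stabEquiv {s t : ℕ} (hs : 2 ≤ s) (hst : s.Coprime t) {h : ℤ → ℤ}
    (hh : IsQuasi s t (2 - t) h) {μ : YoungDiagram} (hμ : betaSet μ = abacus s t h) :
    stabSC hs hst μ ≃ stabFun hs h :=
  Equiv.subtypeEquivRight fun w => mem_stabSC_iff hs hst hh hμ w

end CoreAction

/-! ### Transfer of the count to self-conjugate cores -/

theorem mainTheorem2 (s t : ℕ) (hs : 2 ≤ s) (hst : s.Coprime t) :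
    (CoreAction.scCores s t).Finite ∧
      (∀ μ ∈ CoreAction.scCores s t, Finite (CoreAction.stabSC hs hst μ)) ∧
      ∑ᶠ μ ∈ CoreAction.scCores s t, (1 : ℚ) / (Nat.card (CoreAction.stabSC hs hst μ) : ℚ) =
        (t : ℚ) ^ (s / 2) / ((2 : ℚ) ^ (s / 2) * (Nat.factorial (s / 2) : ℚ)) := by
  have ht : 0 < t := by
    rcases Nat.eq_zero_or_pos t with rfl | h
    · rw [Nat.coprime_zero_right] at hst
      omega
    · exact h
  have hbij := CoreAction.bijOn_abacusDiagram hs ht hst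
  -- With `C = 2 - t` and `T = t` the sum `C + T` is `2`, so the forced middle value is the integer
  -- `1`.
  have hTC : s % 2 = 1 → (2 - (t : ℤ) + t) % 2 = 0 := by omega
  refine ⟨?_, ?_, ?_⟩
  · rw [← hbij.image_eq]
    exact (CoreAction.finite_sorted hs ht hTC).image _
  · intro μ hμ
    rw [← hbij.image_eq] at hμ
    obtain ⟨h, hh, rfl⟩ := hμ
    have := CoreAction.finite_stabFun hs (by omega) hh.1
    exact Finite.of_equiv _ (CoreAction.stabEquiv hs hst hh.1
      (CoreAction.betaSet_abacusDiagram hs hst hh.1)).symm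
  · rw [← CoreAction.sum_inv_card_stabFun hs ht hTC]
    refine (finsum_mem_eq_of_bijOn _ hbij fun h hh => ?_).symm
    rw [Nat.card_congr (CoreAction.stabEquiv hs hst hh.1
      (CoreAction.betaSet_abacusDiagram hs hst hh.1))]
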